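/- Let $[n]=\{1,\dots,n\}$ and $\vec r=(r_1<\dots<r_s)$ with $1\le r_i<n$. An $(\vec r,n)$-flag matroid is a sequence $\vec Q=(Q_1,\dots,Q_s)$ of matroids on $[n]$, identified with their sets of bases, such that $Q_i$ has rank $r_i$ and, for $i\le j$, every flat of $Q_i$ is a flat of $Q_j$. Its polytope is $$\Delta(\vec Q)=\operatorname{conv}\{e_{\lambda_1}+\dots+e_{\lambda_s} : \lambda_i\in Q_i\}\subset\mathbb R^n,$$ where $e_\lambda=\sum_{k\in\lambda}e_k$. For flag matroids $\vec P,\vec Q$ of the same type write $\vec P\le\vec Q$ if there is $v\in\mathbb R^n$ such that, for every $i$, $P_i$ is the set of those $\lambda\in Q_i$ for which $\sum_{k\in\lambda}v_k$ is minimal; such a $\vec P$ is internal if $\Delta(\vec P)$ meets the relative interior of the polytope $\Delta(\vec r,n)$ of the uniform flag matroid (for $\vec r=(1,\dots,n-1)$ this is the permutahedron $\Pi_n$). The flag variety $\mathrm{Fl}(\vec r,n)$ of flags $F_1\subset\dots\subset F_s\subset\mathbb C^n$ with $\dim F_i=r_i$ is embedded in $\mathbb P(\wedge^{r_1}\mathbb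 C^n)\times\dots\times\mathbb P(\wedge^{r_s}\mathbb C^n)$ by Plücker coordinates $p_\lambda$; let $I_{\vec r,n}$ be its multihomogeneous ideal. The stratum $\mathrm{Fl}(\vec Q)$ is the scheme-theoretic intersection of $\mathrm{Fl}(\vec r,n)$ with the locus where $p_\lambda\ne0$ for $\lambda\in Q_i$ and $p_\lambda=0$ for $\lambda\notin Q_i$ ($|\lambda|=r_i$, $i=1,\dots,s$). Explicitly, $\mathrm{Fl}(\vec Q)$ is the spectrum of the ring of $\mathbb G_m^s$-invariants of $R_{\vec Q}=S_{\vec Q}^{-1}B_{\vec Q}/I_{\vec Q}$, where $B_{\vec Q}=\mathbb C[p_\lambda:\lambda\in Q_1\cup\dots\cup Q_s]$, $I_{\vec Q}=(I_{\vec r,n}+\langle p_\lambda:\lambda\notin Q_1\cup\dots\cup Q_s\rangle)\cap B_{\vec Q}$, $S_{\vec Q}$ is the multiplicative set generated by the variables of $B_{\vec Q}$, and the $i$-th factor of $\mathbb G_m^s$ scales the $p_\lambda$ with $|\lambda|=r_i$. If $\vec P\le\vec Q$, the inclusion $B_{\vec P}\subset B_{\vec Q}$ maps $I_{\vec P}$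 into $I_{\vec Q}$ and so induces the face morphism $\varphi_{\vec Q,\vec P}:\mathrm{Fl}(\vec Q)\to\mathrm{Fl}(\vec P)$. **Proposition.** Let $\vec Q$ be a flag matroid of ranks $(1,2,3)$ on $[4]$ with $\dim\Delta(\vec Q)=3$, and let $\vec P\le\vec Q$ be internal. Then the face morphism $\varphi_{\vec Q,\vec P}:\mathrm{Fl}(\vec Q)\to\mathrm{Fl}(\vec P)$ is a smooth and dominant morphism of schemes, and its (nonempty) scheme-theoretic fibers, over all points of the image, are connected. -/

import Mathlib

open AlgebraicGeometry CategoryTheory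

/-- A flag matroid on `[n]` with rank vector `r = (r₁, …, rₛ)`: matroids `Q₁, …, Qₛ` on `[n]` of
ranks `r₁, …, rₛ` such that `Qᵢ` is a quotient of `Qⱼ` for `i ≤ j`, that is, every flat of `Qᵢ`
is a flat of `Qⱼ`. -/
structure FlagMatroid (n : ℕ) {s : ℕ} (r : Fin s → ℕ) where
  /-- the constituents -/
  matroid : Fin s → Matroid (Fin n)
  ground_eq : ∀ i, (matroid i).E = Set.univ
  eRank_eq : ∀ i, (matroid i).eRank = r i
  isFlat_of_le : ∀ i j, i ≤ j → ∀ F : Set (Fin n), (matroid i).IsFlat F → (matroid j).IsFlat F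

/-- The convex hull in `ℝⁿ` of the points `e_{λ₁} + ⋯ + e_{λₛ}` with `λᵢ ∈ B i`, where `e_λ` is the
indicator vector of `λ ⊆ [n]`: the polytope of the Minkowski sum of the point configurations
`λ ↦ e_λ` on `B 1, …, B s`. -/
def minkowskiPolytope {n s : ℕ} (B : Fin s → Set (Finset (Fin n))) : Set (Fin n → ℝ) :=
  convexHull ℝ {p | ∃ l : Fin s → Finset (Fin n), (∀ i, l i ∈ B i) ∧
    p = ∑ i, (fun k => if k ∈ l i then (1 : ℝ) else 0)}

/-- The polytope `Δ(r, n)`, the sum of the hypersimplices `Δ(rᵢ, n)`, which is the polytope of the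
uniform flag matroid. For `r = (1, …, n - 1)` it is the permutahedron. -/
def uniformFlagPolytope (n : ℕ) {s : ℕ} (r : Fin s → ℕ) : Set (Fin n → ℝ) :=
  minkowskiPolytope fun i => {l : Finset (Fin n) | l.card = r i}

/-- Indices of the Plücker coordinates on `ℙ(∧^{r₁} ℂⁿ) × ⋯ × ℙ(∧^{rₛ} ℂⁿ)`. -/
abbrev PluckerIndex (n : ℕ) {s : ℕ} (r : Fin s → ℕ) : Type :=
  {x : Fin s × Finset (Fin n) // x.2.card = r x.1}

/-- The minor of `A` on its first `|l|` rows and the columns in `l`, i.e. the Plücker coordinate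
indexed by `l` of the span of the first `|l|` rows of `A`. -/
noncomputable def initialMinor {n : ℕ} (A : Matrix (Fin n) (Fin n) ℂ) (l : Finset (Fin n)) : ℂ :=
  (A.submatrix (Fin.castLE (card_finset_fin_le l)) (l.orderEmbOfFin rfl)).det

/-- The multicone over the flag variety `Fl(r, n)`: all systems of multihomogeneous Plücker
coordinates of flags `F₁ ⊆ ⋯ ⊆ Fₛ ⊆ ℂⁿ` with `dim Fᵢ = rᵢ`. The flag is given by an invertible
matrix whose first `rᵢ` rows span `Fᵢ`, and `c i` is the choice of the homogeneous scalar. -/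
def flagCone (n : ℕ) {s : ℕ} (r : Fin s → ℕ) : Set (PluckerIndex n r → ℂ) :=
  {p | ∃ A : Matrix (Fin n) (Fin n) ℂ, A.det ≠ 0 ∧ ∃ c : Fin s → ℂˣ,
    ∀ x : PluckerIndex n r, p x = c x.1.1 * initialMinor A x.1.2}

/-- The multihomogeneous ideal of the flag variety `Fl(r, n)`. -/
noncomputable def flagIdeal (n : ℕ) {s : ℕ} (r : Fin s → ℕ) :
    Ideal (MvPolynomial (PluckerIndex n r) ℂ) :=
  MvPolynomial.vanishingIdeal ℂ (flagCone n r)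

/-- The rescaling `p_x ↦ a_x p_x` of the variables of a polynomial ring. -/
noncomputable def rescale {σ : Type} (a : σ → ℂ) : MvPolynomial σ ℂ →ₐ[ℂ] MvPolynomial σ ℂ :=
  MvPolynomial.aeval fun x => MvPolynomial.C (a x) * MvPolynomial.X x

theorem rescale_X {σ : Type} (a : σ → ℂ) (x : σ) :
    rescale a (MvPolynomial.X x) = MvPolynomial.C (a x) * MvPolynomial.X x := by
  simp [rescale]

theorem rescale_monomial {σ : Type} (a : σ → ℂ) (m : σ →₀ ℕ) (k : ℂ) :
    rescale a (MvPolynomial.monomial m k) =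
      MvPolynomial.C (m.prod fun x e => a x ^ e) * MvPolynomial.monomial m k := by
  rw [rescale, MvPolynomial.aeval_monomial, MvPolynomial.monomial_eq]
  simp only [mul_pow, Finsupp.prod_mul, MvPolynomial.algebraMap_eq]
  simp only [Finsupp.prod, map_prod, map_pow]
  ring

theorem aeval_rescale {σ : Type} (a y : σ → ℂ) (f : MvPolynomial σ ℂ) :
    MvPolynomial.aeval y (rescale a f) = MvPolynomial.aeval (fun x => a x * y x) f := by
  rw [rescale, ← AlgHom.comp_apply]
  congr 1
  ext x
  simp

theorem initialMinor_mul_diagonal {n : ℕ} (A : Matrix (Fin n) (Fin n) ℂ) (h : Fin n → ℂ)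
    (l : Finset (Fin n)) :
    initialMinor (A * Matrix.diagonal h) l = (∏ j ∈ l, h j) * initialMinor A l := by
  have h1 : (A * Matrix.diagonal h).submatrix (Fin.castLE (card_finset_fin_le l))
      (l.orderEmbOfFin rfl) =
      Matrix.of fun i j => h (l.orderEmbOfFin rfl j) *
        (A.submatrix (Fin.castLE (card_finset_fin_le l)) (l.orderEmbOfFin rfl)) i j := by
    ext i j
    simp [Matrix.mul_diagonal, mul_comm]
  have h2 : ∏ j ∈ l, h j = ∏ i, h (l.orderEmbOfFin rfl i) := by
    conv_lhs => rw [← Finset.image_orderEmbOfFin_univ l rfl]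
    rw [Finset.prod_image]
    exact fun _ _ _ _ e => (l.orderEmbOfFin rfl).injective e
  rw [initialMinor, h1, Matrix.det_mul_row, h2, initialMinor]

/-- The ideal of the flag variety is stable under the tori scaling the factors and the columns. -/
theorem rescale_mem_flagIdeal {n s : ℕ} {r : Fin s → ℕ} (c : Fin s → ℂˣ) (h : Fin n → ℂˣ)
    {f : MvPolynomial (PluckerIndex n r) ℂ} (hf : f ∈ flagIdeal n r) :
    rescale (fun x => (c x.1.1 : ℂ) * ∏ j ∈ x.1.2, (h j : ℂ)) f ∈ flagIdeal n r := by
  rintro y ⟨A, hA, d, hy⟩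
  rw [aeval_rescale]
  apply hf
  refine ⟨A * Matrix.diagonal fun j => (h j : ℂ), ?_, c * d, fun x => ?_⟩
  · rw [Matrix.det_mul, Matrix.det_diagonal]
    exact mul_ne_zero hA (Finset.prod_ne_zero_iff.mpr fun j _ => (h j).ne_zero)
  · beta_reduce
    rw [initialMinor_mul_diagonal, hy]
    simp only [Pi.mul_apply, Units.val_mul]
    ring

/-- If a linear combination of an eigenvector of eigenvalue `1` and of eigenvectors of other
eigenvalues lies in a stable subspace, then so does the first eigenvector. -/
theorem mem_of_sub_sum_mem {V ι : Type} [AddCommGroup V] [Module ℂ V] (K : Submodule ℂ V)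
    (T : V →ₗ[ℂ] V) (hT : ∀ v ∈ K, T v ∈ K) (f : V) (hf : T f = f) (e : ι → ℂ) (S : Finset ι)
    (he : ∀ m ∈ S, e m ≠ 1) : ∀ g : ι → V, (∀ m ∈ S, T (g m) = e m • g m) →
      f - ∑ m ∈ S, g m ∈ K → f ∈ K := by
  classical
  induction S using Finset.induction_on with
  | empty => intro g _ h; simpa using h
  | insert a S ha ih =>
    intro g hg h
    have hne : (1 : ℂ) - e a ≠ 0 := sub_ne_zero.mpr (he a (by simp)).symm
    refine ih (fun m hm => he m (by simp [hm]))
      (fun m => ((1 - e a)⁻¹ * (e m - e a)) • g m) (fun m hm => ?_) ?_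
    · rw [map_smul, hg m (by simp [hm]), smul_comm]
    · have h1 := K.smul_mem (1 - e a)⁻¹ (K.sub_mem (hT _ h) (K.smul_mem (e a) h))
      have h2 : f - ∑ m ∈ S, ((1 - e a)⁻¹ * (e m - e a)) • g m =
          (1 - e a)⁻¹ • (T (f - ∑ m ∈ insert a S, g m) - e a • (f - ∑ m ∈ insert a S, g m)) := by
        have h3 : T (f - ∑ m ∈ insert a S, g m) - e a • (f - ∑ m ∈ insert a S, g m) =
            (1 - e a) • f - ∑ m ∈ S, (e m - e a) • g m := by
          rw [map_sub, hf, map_sum, Finset.sum_congr rfl hg, Finset.sum_insert ha,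
            Finset.sum_insert ha]
          simp only [sub_smul, one_smul, smul_sub, smul_add, Finset.sum_sub_distrib,
            Finset.smul_sum]
          abel
        rw [h3, smul_sub, smul_smul, inv_mul_cancel₀ hne, one_smul, Finset.smul_sum]
        simp only [smul_smul]
      rw [h2]
      exact h1

namespace FlagMatroid

variable {n s : ℕ} {r : Fin s → ℕ}

/-- The set of bases of the `i`-th constituent. -/
def bases (Q : FlagMatroid n r) (i : Fin s) : Set (Finset (Fin n)) :=
  {b | (Q.matroid i).IsBase (b : Set (Fin n))}

theorem card_of_mem_bases (Q : FlagMatroid n r) {i : Fin s} {b : Finset (Fin n)}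
    (hb : b ∈ Q.bases i) : b.card = r i := by
  have h := Matroid.IsBase.encard_eq_eRank hb
  rw [Q.eRank_eq, Set.encard_coe_eq_coe_finsetCard] at h
  exact_mod_cast h

theorem bases_nonempty (Q : FlagMatroid n r) (i : Fin s) : ∃ b, b ∈ Q.bases i := by
  obtain ⟨B, hB⟩ := (Q.matroid i).exists_isBase
  exact ⟨(Set.toFinite B).toFinset, by simpa [bases] using hB⟩

/-- The flag matroid polytope `Δ(Q)`. -/
def polytope (Q : FlagMatroid n r) : Set (Fin n → ℝ) :=
  minkowskiPolytope Q.bases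

/-- The dimension of the flag matroid polytope. -/
noncomputable def polytopeDim (Q : FlagMatroid n r) : ℕ :=
  Module.finrank ℝ (vectorSpan ℝ Q.polytope)

/-- The face order `P ≤ Q`: there is a weight vector `v` such that, for each `i`, the bases of `Pᵢ`
are the bases of `Qᵢ` of minimal `v`-weight. -/
def IsFace (P Q : FlagMatroid n r) : Prop :=
  ∃ v : Fin n → ℝ, ∀ i, P.bases i =
    {b | b ∈ Q.bases i ∧ ∀ c ∈ Q.bases i, ∑ j ∈ b, v j ≤ ∑ j ∈ c, v j}

/-- The flag matroid `P` is internal if its polytope meets the relative interior of `Δ(r, n)`. -/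
def IsInternal (P : FlagMatroid n r) : Prop :=
  (P.polytope ∩ intrinsicInterior ℝ (uniformFlagPolytope n r)).Nonempty

/-- Indices of the Plücker coordinates that do not vanish on the stratum of `Q`. -/
abbrev BasisIndex (Q : FlagMatroid n r) : Type :=
  {x : Fin s × Finset (Fin n) // x.2 ∈ Q.bases x.1}

/-- The inclusion of the bases of `Q` into all Plücker indices. -/
def basisIncl (Q : FlagMatroid n r) (b : Q.BasisIndex) : PluckerIndex n r :=
  ⟨b.1, Q.card_of_mem_bases b.2⟩

/-- The ideal `I_{r,n} + ⟨p_λ : λ not a basis of Q⟩`. -/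
noncomputable def bigIdeal (Q : FlagMatroid n r) : Ideal (MvPolynomial (PluckerIndex n r) ℂ) :=
  flagIdeal n r ⊔ Ideal.span (MvPolynomial.X '' {x | x.1.2 ∉ Q.bases x.1.1})

/-- The ring `B_Q = ℂ[p_λ : λ ∈ Q₁] ⊗ ⋯ ⊗ ℂ[p_λ : λ ∈ Qₛ]`. -/
abbrev BRing (Q : FlagMatroid n r) : Type := MvPolynomial Q.BasisIndex ℂ

/-- The ideal `I_Q = (I_{r,n} + ⟨p_λ : λ not a basis of Q⟩) ∩ B_Q`. -/
noncomputable def ideal (Q : FlagMatroid n r) : Ideal Q.BRing :=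
  Q.bigIdeal.comap (MvPolynomial.rename Q.basisIncl)

/-- The image in `B_Q / I_Q` of the multiplicative set `S_Q` generated by the variables of `B_Q`. -/
noncomputable def SMonoid (Q : FlagMatroid n r) : Submonoid (Q.BRing ⧸ Q.ideal) :=
  Submonoid.closure (Set.range fun b => Ideal.Quotient.mk Q.ideal (MvPolynomial.X b))

/-- The ring `R_Q = S_Q⁻¹ B_Q / I_Q`. -/
def RRing (Q : FlagMatroid n r) : Type := Localization Q.SMonoid

noncomputable instance (Q : FlagMatroid n r) : CommRing Q.RRing :=
  inferInstanceAs (CommRing (Localization Q.SMonoid))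

noncomputable instance (Q : FlagMatroid n r) : Algebra (Q.BRing ⧸ Q.ideal) Q.RRing :=
  inferInstanceAs (Algebra (Q.BRing ⧸ Q.ideal) (Localization Q.SMonoid))

noncomputable instance (Q : FlagMatroid n r) : Algebra ℂ Q.RRing :=
  inferInstanceAs (Algebra ℂ (Localization Q.SMonoid))

instance (Q : FlagMatroid n r) : IsScalarTower ℂ (Q.BRing ⧸ Q.ideal) Q.RRing :=
  inferInstanceAs (IsScalarTower ℂ (Q.BRing ⧸ Q.ideal) (Localization Q.SMonoid))

instance (Q : FlagMatroid n r) : IsLocalization Q.SMonoid Q.RRing :=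
  inferInstanceAs (IsLocalization Q.SMonoid (Localization Q.SMonoid))

/-- The canonical map `B_Q → R_Q`. -/
noncomputable def toRRing (Q : FlagMatroid n r) : Q.BRing →ₐ[ℂ] Q.RRing :=
  (IsScalarTower.toAlgHom ℂ (Q.BRing ⧸ Q.ideal) Q.RRing).comp (Ideal.Quotient.mkₐ ℂ Q.ideal)

theorem toRRing_eq_zero (Q : FlagMatroid n r) {f : Q.BRing} (hf : f ∈ Q.ideal) :
    Q.toRRing f = 0 := by
  have : Ideal.Quotient.mkₐ ℂ Q.ideal f = 0 := Ideal.Quotient.eq_zero_iff_mem.mpr hf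
  rw [toRRing, AlgHom.comp_apply, this, map_zero]

theorem isUnit_toRRing_X (Q : FlagMatroid n r) (b : Q.BasisIndex) :
    IsUnit (Q.toRRing (MvPolynomial.X b)) :=
  IsLocalization.map_units Q.RRing
    (⟨_, Submonoid.subset_closure ⟨b, rfl⟩⟩ : Q.SMonoid)

theorem algHom_ext (Q : FlagMatroid n r) {A : Type} [CommRing A] [Algebra ℂ A]
    {f g : Q.RRing →ₐ[ℂ] A}
    (h : ∀ b, f (Q.toRRing (MvPolynomial.X b)) = g (Q.toRRing (MvPolynomial.X b))) : f = g := by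
  apply IsLocalization.algHom_ext Q.SMonoid
  apply Ideal.Quotient.algHom_ext
  apply MvPolynomial.algHom_ext
  exact h

/-- The homomorphism `R_Q → A` induced by a homomorphism `B_Q → A` that kills `I_Q` and sends the
variables to units. -/
noncomputable def liftR (Q : FlagMatroid n r) {A : Type} [CommRing A] [Algebra ℂ A]
    (φ : Q.BRing →ₐ[ℂ] A) (h0 : ∀ f ∈ Q.ideal, φ f = 0)
    (hu : ∀ b, IsUnit (φ (MvPolynomial.X b))) : Q.RRing →ₐ[ℂ] A :=
  IsLocalization.liftAlgHom (M := Q.SMonoid) (f := Ideal.Quotient.liftₐ Q.ideal φ h0) (by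
    rintro ⟨y, hy⟩
    have : Q.SMonoid ≤ (IsUnit.submonoid A).comap (Ideal.Quotient.liftₐ Q.ideal φ h0) := by
      rw [SMonoid, Submonoid.closure_le]
      rintro _ ⟨b, rfl⟩
      exact hu b
    exact this hy)

theorem liftR_toRRing (Q : FlagMatroid n r) {A : Type} [CommRing A] [Algebra ℂ A]
    (φ : Q.BRing →ₐ[ℂ] A) (h0 : ∀ f ∈ Q.ideal, φ f = 0)
    (hu : ∀ b, IsUnit (φ (MvPolynomial.X b))) (f : Q.BRing) :
    Q.liftR φ h0 hu (Q.toRRing f) = φ f := by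
  simp only [liftR, toRRing, AlgHom.comp_apply, IsScalarTower.coe_toAlgHom',
    IsLocalization.coe_liftAlgHom, IsLocalization.lift_eq]
  rfl

theorem rescale_mem_bigIdeal (Q : FlagMatroid n r) (c : Fin s → ℂˣ) (h : Fin n → ℂˣ)
    {f : MvPolynomial (PluckerIndex n r) ℂ} (hf : f ∈ Q.bigIdeal) :
    rescale (fun x => (c x.1.1 : ℂ) * ∏ j ∈ x.1.2, (h j : ℂ)) f ∈ Q.bigIdeal := by
  suffices H : Q.bigIdeal ≤ Q.bigIdeal.comap
      (rescale (fun x => (c x.1.1 : ℂ) * ∏ j ∈ x.1.2, (h j : ℂ))) from H hf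
  refine sup_le (fun g hg => ?_) (Ideal.span_le.mpr ?_)
  · exact Ideal.mem_sup_left (rescale_mem_flagIdeal c h hg)
  · rintro _ ⟨x, hx, rfl⟩
    show rescale _ _ ∈ Q.bigIdeal
    rw [rescale_X]
    exact Ideal.mem_sup_right (Ideal.mul_mem_left _ _ (Ideal.subset_span ⟨x, hx, rfl⟩))

theorem rescale_mem_ideal (Q : FlagMatroid n r) (t : Fin s → ℂˣ) {f : Q.BRing}
    (hf : f ∈ Q.ideal) : rescale (fun b => (t b.1.1 : ℂ)) f ∈ Q.ideal := by
  have h := Q.rescale_mem_bigIdeal t 1 hf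
  have e : (rescale (fun x : PluckerIndex n r => (t x.1.1 : ℂ) * ∏ j ∈ x.1.2, (((1 : Fin n → ℂˣ) j
      : ℂˣ) : ℂ))).comp (MvPolynomial.rename Q.basisIncl) =
      (MvPolynomial.rename Q.basisIncl).comp (rescale fun b : Q.BasisIndex => (t b.1.1 : ℂ)) := by
    apply MvPolynomial.algHom_ext
    intro b
    simp [rescale_X, basisIncl]
  show MvPolynomial.rename Q.basisIncl _ ∈ Q.bigIdeal
  rw [← AlgHom.comp_apply, ← e]
  exact h

/-- The action of `t ∈ 𝔾ₘˢ(ℂ) = (ℂˣ)ˢ` on `R_Q`: it multiplies `p_λ` by `tᵢ` for `λ ∈ Qᵢ`. -/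
noncomputable def torusAct (Q : FlagMatroid n r) (t : Fin s → ℂˣ) : Q.RRing →ₐ[ℂ] Q.RRing :=
  Q.liftR (Q.toRRing.comp (rescale fun b => (t b.1.1 : ℂ)))
    (fun _ hf => Q.toRRing_eq_zero (Q.rescale_mem_ideal t hf))
    (fun b => by
      rw [AlgHom.comp_apply, rescale_X, map_mul]
      exact (((t b.1.1).isUnit.map MvPolynomial.C).map Q.toRRing).mul (Q.isUnit_toRRing_X b))

theorem torusAct_X (Q : FlagMatroid n r) (t : Fin s → ℂˣ) (b : Q.BasisIndex) :
    Q.torusAct t (Q.toRRing (MvPolynomial.X b)) =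
      (t b.1.1 : ℂ) • Q.toRRing (MvPolynomial.X b) := by
  refine (Q.liftR_toRRing _ _ _ _).trans ?_
  rw [AlgHom.comp_apply, rescale_X, ← MvPolynomial.smul_eq_C_mul, map_smul]

/-- The coordinate ring of the stratum of `Q`: the subring of `𝔾ₘˢ`-invariants of `R_Q`. -/
noncomputable def coordRing (Q : FlagMatroid n r) : Subalgebra ℂ Q.RRing where
  carrier := {f | ∀ t : Fin s → ℂˣ, Q.torusAct t f = f}
  mul_mem' hf hg t := by rw [map_mul, hf t, hg t]
  add_mem' hf hg t := by rw [map_add, hf t, hg t]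
  algebraMap_mem' k t := (Q.torusAct t).commutes k

/-- The flag matroid stratum `Fl(Q) = Fl(r, n) ∩ (T(Q₁) × ⋯ × T(Qₛ))`, an affine scheme. -/
noncomputable def stratum (Q : FlagMatroid n r) : Scheme.{0} :=
  Spec (CommRingCat.of Q.coordRing)

theorem IsFace.mem_bases {P Q : FlagMatroid n r} (h : P.IsFace Q) {i : Fin s}
    {b : Finset (Fin n)} (hb : b ∈ P.bases i) : b ∈ Q.bases i := by
  obtain ⟨v, hv⟩ := h
  rw [hv i] at hb
  exact hb.1

/-- The inclusion `B_P ⊆ B_Q` for a face `P ≤ Q`. -/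
noncomputable def inclB {P Q : FlagMatroid n r} (h : P.IsFace Q) : P.BRing →ₐ[ℂ] Q.BRing :=
  MvPolynomial.rename fun b => ⟨b.1, h.mem_bases b.2⟩

/-- The inclusion `B_P ⊆ B_Q` maps `I_P` into `I_Q`. -/
theorem inclB_mem_ideal {P Q : FlagMatroid n r} (h : P.IsFace Q) {f : P.BRing}
    (hf : f ∈ P.ideal) : inclB h f ∈ Q.ideal := by
  classical
  obtain ⟨v, hv⟩ := id h
  choose b₀ hb₀ using P.bases_nonempty
  -- `u x` is the excess of the weight of `x` over the minimal weight
  let u : PluckerIndex n r → ℝ := fun x => ∑ j ∈ x.1.2, v j - ∑ j ∈ b₀ x.1.1, v j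
  have hb₀' : ∀ i, b₀ i ∈ Q.bases i ∧ ∀ c ∈ Q.bases i, ∑ j ∈ b₀ i, v j ≤ ∑ j ∈ c, v j :=
    fun i => by simpa [hv i] using hb₀ i
  have hu0 : ∀ x : PluckerIndex n r, x.1.2 ∈ P.bases x.1.1 → u x = 0 := fun x hx => by
    rw [hv] at hx
    exact sub_eq_zero.mpr (le_antisymm (hx.2 _ (hb₀' _).1) ((hb₀' _).2 _ hx.1))
  have hu1 : ∀ x : PluckerIndex n r, x.1.2 ∈ Q.bases x.1.1 → 0 ≤ u x := fun x hx =>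
    sub_nonneg.mpr ((hb₀' _).2 _ hx)
  have hu2 : ∀ x : PluckerIndex n r, x.1.2 ∈ Q.bases x.1.1 → x.1.2 ∉ P.bases x.1.1 → 0 < u x := by
    intro x hx hx'
    refine lt_of_le_of_ne (hu1 x hx) fun h0 => hx' ?_
    rw [hv]
    exact ⟨hx, fun c hc => by
      have := (hb₀' x.1.1).2 c hc
      have h0 := sub_eq_zero.mp h0.symm
      linarith⟩
  let t : ℝ → ℂˣ := fun z => Units.mk0 (Real.exp z : ℂ)
    (Complex.ofReal_ne_zero.mpr (Real.exp_pos z).ne')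
  let a : PluckerIndex n r → ℂ := fun x =>
    (t (-∑ j ∈ b₀ x.1.1, v j) : ℂ) * ∏ j ∈ x.1.2, (t (v j) : ℂ)
  have ha : ∀ x, a x = (Real.exp (u x) : ℂ) := fun x => by
    simp only [a, t, u, Units.val_mk0]
    rw [← Complex.ofReal_prod, ← Real.exp_sum, ← Complex.ofReal_mul, ← Real.exp_add]
    congr 2
    ring
  have hF : MvPolynomial.rename Q.basisIncl (inclB h f) = MvPolynomial.rename P.basisIncl f := by
    rw [inclB, MvPolynomial.rename_rename]
    rfl
  show MvPolynomial.rename Q.basisIncl (inclB h f) ∈ Q.bigIdeal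
  rw [hF]
  have hT1 : rescale a (MvPolynomial.rename P.basisIncl f) = MvPolynomial.rename P.basisIncl f := by
    rw [← AlgHom.comp_apply]
    congr 1
    apply MvPolynomial.algHom_ext
    intro b
    have : a (P.basisIncl b) = 1 := by rw [ha, hu0 _ b.2]; simp
    simp [rescale_X, this]
  have hf' : MvPolynomial.rename P.basisIncl f ∈ P.bigIdeal := hf
  obtain ⟨g, hg, k, hk, hgk⟩ := Submodule.mem_sup.mp hf'
  rw [MvPolynomial.mem_ideal_span_X_image] at hk
  let S := k.support.filter fun m => ∀ x ∈ m.support, x.1.2 ∈ Q.bases x.1.1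
  refine mem_of_sub_sum_mem (Q.bigIdeal.restrictScalars ℂ) (rescale a).toLinearMap
    (fun w hw => Q.rescale_mem_bigIdeal (fun i => t (-∑ j ∈ b₀ i, v j)) (fun j => t (v j)) hw)
    (MvPolynomial.rename P.basisIncl f) hT1 (fun m => m.prod fun x e => a x ^ e) S ?_
    (fun m => MvPolynomial.monomial m (k.coeff m)) ?_ ?_
  · intro m hm
    obtain ⟨hm1, hm2⟩ := Finset.mem_filter.mp hm
    have e1 : (m.prod fun x e => a x ^ e) = (Real.exp (∑ x ∈ m.support, m x * u x) : ℂ) := by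
      rw [Finsupp.prod, Real.exp_sum, Complex.ofReal_prod]
      refine Finset.prod_congr rfl fun x _ => ?_
      rw [ha, Real.exp_nat_mul, Complex.ofReal_pow]
    rw [e1]
    obtain ⟨x, hx, hmx⟩ := hk m hm1
    have hpos : 0 < ∑ x ∈ m.support, (m x : ℝ) * u x :=
      Finset.sum_pos' (fun y hy => mul_nonneg (Nat.cast_nonneg _) (hu1 y (hm2 y hy)))
        ⟨x, Finsupp.mem_support_iff.mpr hmx, mul_pos (Nat.cast_pos.mpr (Nat.pos_of_ne_zero hmx))
          (hu2 x (hm2 x (Finsupp.mem_support_iff.mpr hmx)) hx)⟩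
    have := (Real.one_lt_exp_iff.mpr hpos).ne'
    exact_mod_cast this
  · intro m _
    rw [AlgHom.toLinearMap_apply, rescale_monomial, MvPolynomial.smul_eq_C_mul]
  · have hsplit : k = ∑ m ∈ S, MvPolynomial.monomial m (k.coeff m) +
        ∑ m ∈ k.support.filter (fun m => ¬ ∀ x ∈ m.support, x.1.2 ∈ Q.bases x.1.1),
          MvPolynomial.monomial m (k.coeff m) := by
      rw [Finset.sum_filter_add_sum_filter_not]
      exact k.as_sum
    show _ ∈ Q.bigIdeal
    have : MvPolynomial.rename P.basisIncl f - ∑ m ∈ S, MvPolynomial.monomial m (k.coeff m) =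
        g + ∑ m ∈ k.support.filter (fun m => ¬ ∀ x ∈ m.support, x.1.2 ∈ Q.bases x.1.1),
          MvPolynomial.monomial m (k.coeff m) := by
      rw [← hgk]
      nth_rewrite 1 [hsplit]
      abel
    rw [this]
    refine Q.bigIdeal.add_mem (Ideal.mem_sup_left hg) (Q.bigIdeal.sum_mem fun m hm => ?_)
    refine Ideal.mem_sup_right (MvPolynomial.mem_ideal_span_X_image.mpr fun m' hm' => ?_)
    have hmm : m' = m := by
      simpa using MvPolynomial.support_monomial_subset hm'
    subst hmm
    have := (Finset.mem_filter.mp hm).2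
    push Not at this
    obtain ⟨x, hx, hxQ⟩ := this
    exact ⟨x, hxQ, Finsupp.mem_support_iff.mp hx⟩

/-- The homomorphism `R_P → R_Q` induced by the inclusion `B_P ⊆ B_Q`. -/
noncomputable def faceHomR {P Q : FlagMatroid n r} (h : P.IsFace Q) : P.RRing →ₐ[ℂ] Q.RRing :=
  P.liftR (Q.toRRing.comp (inclB h)) (fun _ hf => Q.toRRing_eq_zero (inclB_mem_ideal h hf))
    (fun b => by
      rw [AlgHom.comp_apply, inclB, MvPolynomial.rename_X]
      exact Q.isUnit_toRRing_X _)

theorem faceHomR_torusAct {P Q : FlagMatroid n r} (h : P.IsFace Q) (t : Fin s → ℂˣ)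
    (f : P.RRing) : Q.torusAct t (faceHomR h f) = faceHomR h (P.torusAct t f) := by
  rw [← AlgHom.comp_apply, ← AlgHom.comp_apply]
  congr 1
  apply P.algHom_ext
  intro b
  simp only [AlgHom.comp_apply, torusAct_X, map_smul, faceHomR, liftR_toRRing, inclB,
    MvPolynomial.rename_X]

/-- The homomorphism of coordinate rings of strata induced by the inclusion `B_P ⊆ B_Q`. -/
noncomputable def faceHom {P Q : FlagMatroid n r} (h : P.IsFace Q) :
    P.coordRing →ₐ[ℂ] Q.coordRing :=
  ((faceHomR h).comp P.coordRing.val).codRestrict Q.coordRing fun f t => by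
    rw [AlgHom.comp_apply, faceHomR_torusAct]
    exact congrArg _ (f.2 t)

/-- The face morphism `Fl(Q) ⟶ Fl(P)` for `P ≤ Q`. -/
noncomputable def faceMorphism {P Q : FlagMatroid n r} (h : P.IsFace Q) :
    Q.stratum ⟶ P.stratum :=
  Spec.map (CommRingCat.ofHom (faceHom h).toRingHom)

end FlagMatroid

/-!
A flag of bases of `P` gives a chart of the flag variety that contains the strata of both `P` and
`Q`. In it, `Fl(Q)` is the locus in `𝔸⁶` where prescribed Plücker coordinates vanish and the others
do not. The exchange property makes this vanishing pattern compatible with the Plücker relations,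
and since `P` is internal, the weight vector cutting out a face `P ≠ Q` forces some coordinates to
vanish on both strata. In each case every affine coordinate is a rational expression, with
invertible denominators, in a subset of the six that is algebraically independent because generic
values for it extend to points of the stratum, and the subset for `P` can be completed to one for
`Q`. Hence the coordinate ring of `Fl(Q)` is a localization of a polynomial ring over that of
`Fl(P)`. So the face morphism is smooth and dominant, and primes of the smaller ring that come from
the larger one extend to primes, which makes the nonempty fibers irreducible.
-/

section RingTheory

universe u

open MvPolynomial

theorem isPrime_map_mvPolynomial_C {σ R : Type*} [CommRing R] (I : Ideal R) [I.IsPrime] :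
    (I.map (C : R →+* MvPolynomial σ R)).IsPrime := by
  rw [← Ideal.Quotient.isDomain_iff_prime]
  exact (quotientEquivQuotientMvPolynomial (σ := σ) I).symm.toMulEquiv.isDomain _

theorem isConnected_fiber_of_isPrime_map {B A : Type*} [CommRing B] [CommRing A] (φ : B →+* A)
    {q : PrimeSpectrum A} (h : ((q.asIdeal.comap φ).map φ).IsPrime) :
    _root_.IsConnected (PrimeSpectrum.comap φ ⁻¹' {PrimeSpectrum.comap φ q}) := by
  let η : PrimeSpectrum A := ⟨_, h⟩
  have hη : PrimeSpectrum.comap φ η = PrimeSpectrum.comap φ q := by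
    ext1
    exact le_antisymm (Ideal.comap_mono Ideal.map_comap_le) Ideal.le_comap_map
  -- The fiber contains the generic point of the extended prime and lies in its closure.
  refine ⟨⟨q, rfl⟩, (isPreconnected_singleton (x := η)).subset_closure (by simpa using hη) ?_⟩
  intro q' hq'
  rw [← specializes_iff_mem_closure, ← PrimeSpectrum.le_iff_specializes]
  exact Ideal.map_le_iff_le_comap.mpr (congrArg PrimeSpectrum.asIdeal hq').ge

/-- The ring-theoretic conditions ensuring that `Spec φ` is smooth and dominant with connected
fibers; the last one makes the fibers irreducible. -/
structure IsSmoothConnected {B A : Type*} [CommRing B] [CommRing A] (φ : B →+* A) : Prop where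
  smooth : φ.Smooth
  injective : Function.Injective φ
  isPrime_map_comap : ∀ q : Ideal A, q.IsPrime → ((q.comap φ).map φ).IsPrime

namespace IsSmoothConnected

theorem of_bijective {B A : Type*} [CommRing B] [CommRing A] {φ : B →+* A}
    (hφ : Function.Bijective φ) : IsSmoothConnected φ where
  smooth := .of_bijective hφ
  injective := hφ.1
  isPrime_map_comap q hq := by rwa [Ideal.map_comap_of_surjective φ hφ.2]

theorem spec {B A : Type u} [CommRing B] [CommRing A] {φ : B →+* A} (hφ : IsSmoothConnected φ) :
    AlgebraicGeometry.Smooth (Spec.map (CommRingCat.ofHom φ)) ∧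
      IsDominant (Spec.map (CommRingCat.ofHom φ)) ∧
      ∀ y ∈ Set.range (Spec.map (CommRingCat.ofHom φ)),
        ConnectedSpace ((Spec.map (CommRingCat.ofHom φ)).fiber y) := by
  refine ⟨?_, ⟨?_⟩, ?_⟩
  · rw [HasRingHomProperty.Spec_iff (P := @AlgebraicGeometry.Smooth)]
    exact hφ.smooth
  · have hker : RingHom.ker φ ≤ nilradical B :=
      ((RingHom.injective_iff_ker_eq_bot φ).mp hφ.injective).le.trans bot_le
    exact (PrimeSpectrum.denseRange_comap_iff_ker_le_nilRadical φ).mpr hker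
  · rintro _ ⟨q, rfl⟩
    have hfiber : ConnectedSpace (Spec.map (CommRingCat.ofHom φ) ⁻¹'
        {Spec.map (CommRingCat.ofHom φ) q}) :=
      isConnected_iff_connectedSpace.mp
        (isConnected_fiber_of_isPrime_map φ (hφ.isPrime_map_comap _ q.isPrime))
    exact (Scheme.Hom.fiberHomeo (Spec.map (CommRingCat.ofHom φ)) _).symm.surjective.connectedSpace
      (Homeomorph.continuous _)

end IsSmoothConnected

/-- A subalgebra that contains the inverses of its elements, as far as they exist. -/
def IsInvClosed {R A : Type*} [CommRing R] [CommRing A] [Algebra R A] (L : Subalgebra R A) :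
    Prop :=
  ∀ x y, x ∈ L → x * y = 1 → y ∈ L

/-- The set `S` generates the `R`-algebra `A` up to taking inverses. -/
def RatGenerates (R : Type*) {A : Type*} [CommRing R] [CommRing A] [Algebra R A] (S : Set A) :
    Prop :=
  ∀ L : Subalgebra R A, IsInvClosed L → S ⊆ L → L = ⊤

/-- The fractions of elements of the subalgebra `S` with denominators that are units of `A`. -/
def fractionSubalgebra {R A : Type*} [CommRing R] [CommRing A] [Algebra R A]
    (S : Subalgebra R A) : Subalgebra R A where
  carrier := {a | ∃ d ∈ S, IsUnit d ∧ a * d ∈ S}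
  mul_mem' := by
    rintro a b ⟨d, hd, hdu, had⟩ ⟨e, he, heu, hbe⟩
    exact ⟨d * e, S.mul_mem hd he, hdu.mul heu, by
      rw [mul_mul_mul_comm]; exact S.mul_mem had hbe⟩
  add_mem' := by
    rintro a b ⟨d, hd, hdu, had⟩ ⟨e, he, heu, hbe⟩
    refine ⟨d * e, S.mul_mem hd he, hdu.mul heu, ?_⟩
    rw [show (a + b) * (d * e) = a * d * e + b * e * d by ring]
    exact S.add_mem (S.mul_mem had he) (S.mul_mem hbe hd)
  algebraMap_mem' r := ⟨1, S.one_mem, isUnit_one, by simp⟩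

theorem le_fractionSubalgebra {R A : Type*} [CommRing R] [CommRing A] [Algebra R A]
    (S : Subalgebra R A) : S ≤ fractionSubalgebra S :=
  fun a ha => ⟨1, S.one_mem, isUnit_one, by rwa [mul_one]⟩

theorem isInvClosed_fractionSubalgebra {R A : Type*} [CommRing R] [CommRing A] [Algebra R A]
    (S : Subalgebra R A) : IsInvClosed (fractionSubalgebra S) := by
  rintro a b ⟨d, hd, hdu, had⟩ hab
  refine ⟨a * d, had, (IsUnit.of_mul_eq_one _ hab).mul hdu, ?_⟩
  rwa [← mul_assoc, mul_comm b, hab, one_mul]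

theorem RatGenerates.exists_fraction {R A J : Type*} [CommRing R] [CommRing A] [Algebra R A]
    {y : J → A} (h : RatGenerates R (Set.range y)) (a : A) :
    ∃ f m : MvPolynomial J R, IsUnit (aeval y m) ∧ a * aeval y m = aeval y f := by
  have htop := h _ (isInvClosed_fractionSubalgebra (Algebra.adjoin R (Set.range y)))
    (Algebra.subset_adjoin.trans (le_fractionSubalgebra _))
  obtain ⟨d, hd, hdu, had⟩ : a ∈ fractionSubalgebra (Algebra.adjoin R (Set.range y)) :=
    htop ▸ Algebra.mem_top
  rw [Algebra.adjoin_range_eq_range_aeval] at hd had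
  obtain ⟨m, rfl⟩ := hd
  obtain ⟨f, hf⟩ := had
  exact ⟨f, m, hdu, hf.symm⟩

theorem isLocalization_comap_isUnit {R A : Type*} [CommRing R] [CommRing A] [Algebra R A]
    (hinj : Function.Injective (algebraMap R A))
    (hfrac : ∀ a : A, ∃ f m : R, IsUnit (algebraMap R A m) ∧
      a * algebraMap R A m = algebraMap R A f) :
    IsLocalization ((IsUnit.submonoid A).comap (algebraMap R A)) A where
  map_units m := m.2
  surj a := by
    obtain ⟨f, m, hm, e⟩ := hfrac a
    exact ⟨(f, ⟨m, hm⟩), e⟩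
  exists_of_eq e := ⟨1, by rw [hinj e]⟩

theorem isPrime_map_comap_of_isLocalization {B C A : Type*} [CommRing B] [CommRing C]
    [CommRing A] [Algebra B C] [Algebra C A] [Algebra B A] [IsScalarTower B C A]
    (M : Submonoid C) [IsLocalization M A] {q : Ideal A} [hq : q.IsPrime]
    (h : ((q.comap (algebraMap B A)).map (algebraMap B C)).IsPrime) :
    ((q.comap (algebraMap B A)).map (algebraMap B A)).IsPrime := by
  rw [IsScalarTower.algebraMap_eq B C A] at h ⊢
  rw [← Ideal.map_map]
  refine IsLocalization.isPrime_of_isPrime_disjoint M A _ h (Set.disjoint_left.mpr ?_)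
  intro m hm hm'
  have hmq : m ∈ q.comap (algebraMap C A) := by
    rw [← Ideal.comap_comap] at hm'
    exact Ideal.map_comap_le hm'
  exact hq.ne_top (Ideal.eq_top_of_isUnit_mem _ hmq (IsLocalization.map_units A ⟨m, hm⟩))

theorem algebraicIndependent_of_isLocalization {R S A J : Type*} [CommRing R] [CommRing S]
    [CommRing A] [Algebra R S] [Algebra S A] [Algebra R A] [IsScalarTower R S A]
    (M : Submonoid R) [IsLocalization M S] {y : J → A} (hy : AlgebraicIndependent R y) :
    AlgebraicIndependent S y := by
  rw [AlgebraicIndependent, injective_iff_map_eq_zero]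
  intro f hf
  let : Algebra (MvPolynomial J R) (MvPolynomial J S) := algebraMvPolynomial
  obtain ⟨⟨g, m⟩, e⟩ := IsLocalization.surj (M.map (C (σ := J))) f
  have hg : g = 0 := hy <| by
    rw [map_zero, ← aeval_map_algebraMap S, ← algebraMap_def, ← e, map_mul, hf, zero_mul]
  rw [hg, map_zero] at e
  exact (IsLocalization.map_units _ m).mul_left_eq_zero.mp e

theorem algebraicIndependent_mvPolynomial {k A K J : Type*} [CommRing k] [CommRing A]
    [Algebra k A] [Algebra (MvPolynomial K k) A] [IsScalarTower k (MvPolynomial K k) A]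
    {y : J → A} (h : AlgebraicIndependent k
      (Sum.elim y fun i => algebraMap (MvPolynomial K k) A (X i))) :
    AlgebraicIndependent (MvPolynomial K k) y := by
  have hcomp : aeval (Sum.elim y fun i => algebraMap (MvPolynomial K k) A (X i)) =
      ((aeval y).restrictScalars k).comp (sumAlgEquiv k J K).toAlgHom := by
    ext (_ | _) <;> simp
  rw [AlgebraicIndependent, hcomp] at h
  rw [AlgebraicIndependent]
  simpa using h

theorem algebraicIndependent_of_ratGenerates {k B A K J : Type*} [CommRing k] [CommRing B]
    [CommRing A] [Algebra k B] [Algebra B A] [Algebra k A] [IsScalarTower k B A] {z : K → B}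
    {y : J → A} (hz : RatGenerates k (Set.range z))
    (h : AlgebraicIndependent k (Sum.elim y fun i => algebraMap B A (z i))) :
    AlgebraicIndependent B y := by
  have hz' : AlgebraicIndependent k z :=
    (h.comp _ Sum.inr_injective).of_comp (IsScalarTower.toAlgHom k B A)
  algebraize [(aeval z : MvPolynomial K k →ₐ[k] B).toRingHom,
    (algebraMap B A).comp (aeval z : MvPolynomial K k →ₐ[k] B).toRingHom]
  have : IsScalarTower k (MvPolynomial K k) A := .of_algebraMap_eq fun a => by
    rw [IsScalarTower.algebraMap_apply k B A]
    exact congrArg (algebraMap B A) ((aeval z).commutes a).symm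
  have : IsLocalization ((IsUnit.submonoid B).comap (algebraMap (MvPolynomial K k) B)) B :=
    isLocalization_comap_isUnit hz' hz.exists_fraction
  refine algebraicIndependent_of_isLocalization
    ((IsUnit.submonoid B).comap (algebraMap (MvPolynomial K k) B))
    (algebraicIndependent_mvPolynomial ?_)
  convert h using 3
  exact congrArg (algebraMap B A) (aeval_X z _)

theorem isSmoothConnected_algebraMap {B A J : Type*} [CommRing B] [CommRing A] [Algebra B A]
    [Algebra.FinitePresentation B A] {y : J → A} (hy : AlgebraicIndependent B y)
    (hgen : RatGenerates B (Set.range y)) : IsSmoothConnected (algebraMap B A) := by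
  algebraize [(aeval y : MvPolynomial J B →ₐ[B] A).toRingHom]
  have : IsScalarTower B (MvPolynomial J B) A :=
    .of_algebraMap_eq fun b => ((aeval y).commutes b).symm
  let M := (IsUnit.submonoid A).comap (algebraMap (MvPolynomial J B) A)
  have : IsLocalization M A := isLocalization_comap_isUnit hy hgen.exists_fraction
  have : Algebra.FormallySmooth (MvPolynomial J B) A := .of_isLocalization M
  have : Algebra.FormallySmooth B A := .comp B (MvPolynomial J B) A
  exact {
    smooth := RingHom.smooth_algebraMap.mpr ⟨inferInstance, inferInstance⟩
    injective := hy.algebraMap_injective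
    isPrime_map_comap := fun q hq =>
      isPrime_map_comap_of_isLocalization M (isPrime_map_mvPolynomial_C _) }

theorem RatGenerates.of_restrictScalars {k B A J : Type*} [CommRing k] [CommRing B] [CommRing A]
    [Algebra k B] [Algebra B A] [Algebra k A] [IsScalarTower k B A] {S : Set A} {y : J → A}
    (hS : RatGenerates k S) (h : S ⊆ Set.range (algebraMap B A) ∪ Set.range y) :
    RatGenerates B (Set.range y) := by
  intro L hL hy
  have hLtop : L.restrictScalars k = ⊤ := hS _ hL fun a ha => by
    rcases h ha with ⟨b, rfl⟩ | hay
    · exact L.algebraMap_mem b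
    · exact hy hay
  exact eq_top_iff.mpr fun a _ => by
    rw [← Subalgebra.mem_restrictScalars k, hLtop]
    trivial

theorem algebraicIndependent_sumElim_diff {k A ι : Type*} [CommRing k] [CommRing A]
    [Algebra k A] {y : ι → A} {I I' : Set ι} (hI : I ⊆ I')
    (h : AlgebraicIndependent k fun i : I' => y i) :
    AlgebraicIndependent k
      (Sum.elim (fun j : ↥(I' \ I) => y j) fun i : I => y i) := by
  have hinj : Function.Injective (Sum.elim (Set.inclusion (Set.sdiff_subset (s := I') (t := I)))
      (Set.inclusion hI)) :=
    (Set.inclusion_injective _).sumElim (Set.inclusion_injective _) fun j i e =>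
      j.2.2 (congrArg Subtype.val e ▸ i.2)
  convert h.comp _ hinj
  ext (_ | _) <;> rfl

theorem isSmoothConnected_of_coords {k B A ι : Type*} [CommRing k] [IsNoetherianRing k]
    [CommRing B] [CommRing A] [Algebra k B] [Algebra k A] [Algebra.FiniteType k B]
    [Algebra.FiniteType k A] (φ : B →ₐ[k] A) {yB : ι → B} {yA : ι → A} {I I' : Set ι}
    (hI : I ⊆ I') (hφ : ∀ i ∈ I, φ (yB i) = yA i) (hB : RatGenerates k (yB '' I))
    (hA : RatGenerates k (yA '' I')) (h : AlgebraicIndependent k fun i : I' => yA i) :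
    IsSmoothConnected φ.toRingHom := by
  classical
  algebraize [φ.toRingHom]
  have : IsScalarTower k B A := .of_algebraMap_eq fun r => (φ.commutes r).symm
  have : Algebra.FiniteType B A := .of_restrictScalars_finiteType k B A
  have : IsNoetherianRing B := Algebra.FiniteType.isNoetherianRing k B
  have : Algebra.FinitePresentation B A := Algebra.FinitePresentation.of_finiteType.mp ‹_›
  rw [Set.image_eq_range] at hB
  have hind : AlgebraicIndependent k
      (Sum.elim (fun j : ↥(I' \ I) => yA j) fun i : I => algebraMap B A (yB i)) := by
    convert algebraicIndependent_sumElim_diff hI h using 3 with i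
    exact hφ i i.2
  refine isSmoothConnected_algebraMap (algebraicIndependent_of_ratGenerates hB hind)
    (hA.of_restrictScalars ?_)
  rintro _ ⟨i, hi, rfl⟩
  by_cases hiI : i ∈ I
  · exact Or.inl ⟨yB i, hφ i hiI⟩
  · exact Or.inr ⟨⟨i, hi, hiI⟩, rfl⟩

end RingTheory

namespace FlagMatroid

section TorusInvariants

variable {n s : ℕ} {r : Fin s → ℕ}

/-- The total degree of a monomial in the coordinates of the `i`-th factor. -/
noncomputable def monomialDegree (Q : FlagMatroid n r) (m : Q.BasisIndex →₀ ℕ) (i : Fin s) : ℕ :=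
  ∑ x ∈ m.support with x.1.1 = i, m x

theorem prod_pow_eq_prod_monomialDegree (Q : FlagMatroid n r) {M : Type*} [CommMonoid M]
    (t : Fin s → M) (m : Q.BasisIndex →₀ ℕ) :
    (m.prod fun x e => t x.1.1 ^ e) = ∏ i, t i ^ Q.monomialDegree m i := by
  rw [Finsupp.prod, ← Finset.prod_fiberwise m.support fun x => x.1.1]
  refine Finset.prod_congr rfl fun i _ => ?_
  rw [monomialDegree, ← Finset.prod_pow_eq_pow_sum]
  exact Finset.prod_congr rfl fun x hx => by rw [(Finset.mem_filter.mp hx).2]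

theorem factorization_prod_pow {ι : Type*} [Fintype ι] {p : ι → ℕ} (hp : ∀ i, (p i).Prime)
    (hinj : Function.Injective p) (a : ι → ℕ) (j : ι) :
    (∏ i, p i ^ a i).factorization (p j) = a j := by
  rw [Nat.factorization_prod fun i _ => pow_ne_zero _ (hp i).ne_zero, Finsupp.finsetSum_apply,
    Finset.sum_eq_single j]
  · simp [(hp j).factorization_pow]
  · intro i _ hij
    rw [(hp i).factorization_pow, Finsupp.single_eq_of_ne fun e => hij (hinj e).symm]
  · simp

-- Distinct primes form such a point, by unique factorization.
theorem exists_units_prod_pow_injective (s : ℕ) :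
    ∃ t : Fin s → ℂˣ, Function.Injective fun a : Fin s → ℕ => ∏ i, (t i : ℂ) ^ a i := by
  let p : Fin s → ℕ := fun i => Nat.nth Nat.Prime i
  have hp : ∀ i, (p i).Prime := fun i => Nat.prime_nth_prime i
  have hinj : Function.Injective p := fun i j h =>
    Fin.ext (Nat.nth_injective Nat.infinite_setOfPred_prime h)
  refine ⟨fun i => Units.mk0 (p i : ℂ) (Nat.cast_ne_zero.mpr (hp i).ne_zero), fun a b h => ?_⟩
  have hab : ∏ i, p i ^ a i = ∏ i, p i ^ b i := by
    simp only [Units.val_mk0] at h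
    exact_mod_cast h
  ext j
  rw [← factorization_prod_pow hp hinj a j, hab, factorization_prod_pow hp hinj]

theorem torusAct_toRRing (Q : FlagMatroid n r) (t : Fin s → ℂˣ) (f : Q.BRing) :
    Q.torusAct t (Q.toRRing f) = Q.toRRing (rescale (fun x => (t x.1.1 : ℂ)) f) :=
  Q.liftR_toRRing _ _ _ _

theorem torusAct_monomial (Q : FlagMatroid n r) (t : Fin s → ℂˣ) (m : Q.BasisIndex →₀ ℕ) (a : ℂ) :
    Q.torusAct t (Q.toRRing (MvPolynomial.monomial m a)) =
      (∏ i, (t i : ℂ) ^ Q.monomialDegree m i) • Q.toRRing (MvPolynomial.monomial m a) := by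
  rw [torusAct_toRRing, rescale_monomial, Q.prod_pow_eq_prod_monomialDegree fun i => (t i : ℂ),
    ← MvPolynomial.smul_eq_C_mul, map_smul]

theorem toRRing_eq_sum_of_torusAct (Q : FlagMatroid n r) {d : Fin s → ℕ} {g : Q.BRing}
    (hg : ∀ t, Q.torusAct t (Q.toRRing g) = (∏ i, (t i : ℂ) ^ d i) • Q.toRRing g) :
    Q.toRRing g = ∑ m ∈ g.support with Q.monomialDegree m = d,
      Q.toRRing (MvPolynomial.monomial m (g.coeff m)) := by
  obtain ⟨t, ht⟩ := exists_units_prod_pow_injective s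
  let weight : (Fin s → ℕ) → ℂ := fun a => ∏ i, (t i : ℂ) ^ a i
  have hd : weight d ≠ 0 := Finset.prod_ne_zero_iff.mpr fun i _ => pow_ne_zero _ (t i).ne_zero
  let T : Q.RRing →ₗ[ℂ] Q.RRing := (weight d)⁻¹ • (Q.torusAct t).toLinearMap
  have hT : ∀ m, T (Q.toRRing (MvPolynomial.monomial m (g.coeff m))) =
      ((weight d)⁻¹ * weight (Q.monomialDegree m)) •
        Q.toRRing (MvPolynomial.monomial m (g.coeff m)) := fun m => by
    rw [mul_smul, ← Q.torusAct_monomial t]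
    rfl
  have hTg : T (Q.toRRing g) = Q.toRRing g := (inv_smul_eq_iff₀ hd).mpr (hg t)
  have hfix : T (∑ m ∈ g.support with Q.monomialDegree m = d,
      Q.toRRing (MvPolynomial.monomial m (g.coeff m))) =
      ∑ m ∈ g.support with Q.monomialDegree m = d,
        Q.toRRing (MvPolynomial.monomial m (g.coeff m)) := by
    rw [map_sum]
    refine Finset.sum_congr rfl fun m hm => ?_
    rw [hT, (Finset.mem_filter.mp hm).2, inv_mul_cancel₀ hd, one_smul]
  refine sub_eq_zero.mp ((Submodule.mem_bot ℂ).mp <| mem_of_sub_sum_mem ⊥ T (by simp) _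
    (by rw [map_sub, hTg, hfix]) _ (g.support.filter fun m => ¬ Q.monomialDegree m = d)
    (fun m hm h => (Finset.mem_filter.mp hm).2 (ht ((inv_mul_eq_one₀ hd).mp h).symm)) _
    (fun m _ => hT m) ?_)
  · rw [sub_sub, Finset.sum_filter_add_sum_filter_not, ← map_sum, ← g.as_sum, sub_self]
    exact Submodule.zero_mem _

/-- The Plücker coordinate of a basis, as an invertible element of `R_Q`. -/
noncomputable def coord (Q : FlagMatroid n r) {i : Fin s} (b : Q.bases i) : Q.RRing :=
  Q.toRRing (MvPolynomial.X ⟨(i, b), b.2⟩)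

theorem isUnit_coord (Q : FlagMatroid n r) {i : Fin s} (b : Q.bases i) : IsUnit (Q.coord b) :=
  Q.isUnit_toRRing_X _

theorem torusAct_inverse_coord (Q : FlagMatroid n r) {i : Fin s} (b : Q.bases i)
    (t : Fin s → ℂˣ) : Q.torusAct t (Ring.inverse (Q.coord b)) =
      (t i : ℂ)⁻¹ • Ring.inverse (Q.coord b) := by
  have h : Q.torusAct t (Q.coord b) = (t i : ℂ) • Q.coord b := Q.torusAct_X t _
  refine (((Q.isUnit_coord b).map (Q.torusAct t))).mul_left_injective ?_
  simp only [← map_mul]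
  rw [Ring.inverse_mul_cancel _ (Q.isUnit_coord b), map_one, h, smul_mul_smul_comm,
    Ring.inverse_mul_cancel _ (Q.isUnit_coord b), inv_mul_cancel₀ (t i).ne_zero, one_smul]

/-- The quotient of the coordinates of two bases of the same constituent, a regular function on the
stratum. -/
noncomputable def ratio (Q : FlagMatroid n r) {i : Fin s} (b c : Q.bases i) : Q.coordRing :=
  ⟨Q.coord b * Ring.inverse (Q.coord c), fun t => by
    have h : Q.torusAct t (Q.coord b) = (t i : ℂ) • Q.coord b := Q.torusAct_X t _
    rw [map_mul, h, torusAct_inverse_coord, smul_mul_smul_comm, mul_inv_cancel₀ (t i).ne_zero,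
      one_smul]⟩

theorem ratio_mul_coord (Q : FlagMatroid n r) {i : Fin s} (b c : Q.bases i) :
    Q.ratio b c * Q.coord c = Q.coord b := by
  rw [ratio, mul_assoc, Ring.inverse_mul_cancel _ (Q.isUnit_coord c), mul_one]

theorem ratio_mul_ratio (Q : FlagMatroid n r) {i : Fin s} (b c : Q.bases i) :
    Q.ratio b c * Q.ratio c b = 1 := by
  apply Subtype.ext
  refine (Q.isUnit_coord b).mul_left_injective ?_
  simp only [Subalgebra.coe_mul, mul_assoc, ratio_mul_coord, Subalgebra.coe_one, one_mul]

theorem toRRing_monomial (Q : FlagMatroid n r) (b₀ : ∀ i, Q.bases i) (m : Q.BasisIndex →₀ ℕ)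
    (a : ℂ) : Q.toRRing (MvPolynomial.monomial m a) =
      (a • m.prod fun x e => Q.ratio ⟨x.1.2, x.2⟩ (b₀ x.1.1) ^ e : Q.coordRing) *
        ∏ i, Q.coord (b₀ i) ^ Q.monomialDegree m i := by
  rw [← Q.prod_pow_eq_prod_monomialDegree fun i => Q.coord (b₀ i), MvPolynomial.monomial_eq,
    ← MvPolynomial.smul_eq_C_mul, map_smul, Subalgebra.coe_smul, smul_mul_assoc]
  simp only [Finsupp.prod, map_prod, map_pow, SubmonoidClass.coe_finsetProd,
    SubmonoidClass.coe_pow, ← Finset.prod_mul_distrib, ← mul_pow, ratio_mul_coord]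
  rfl

theorem exists_monomial_of_mem_SMonoid (Q : FlagMatroid n r) {x : Q.BRing ⧸ Q.ideal}
    (hx : x ∈ Q.SMonoid) :
    ∃ m : Q.BasisIndex →₀ ℕ, x = Ideal.Quotient.mk Q.ideal (MvPolynomial.monomial m 1) := by
  induction hx using Submonoid.closure_induction with
  | mem x hx => obtain ⟨b, rfl⟩ := hx; exact ⟨_, rfl⟩
  | one => exact ⟨0, by simp⟩
  | mul x y _ _ hx hy =>
    obtain ⟨m, rfl⟩ := hx
    obtain ⟨m', rfl⟩ := hy
    exact ⟨m + m', by rw [← map_mul, MvPolynomial.monomial_mul, mul_one]⟩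

theorem exists_mul_monomial_eq (Q : FlagMatroid n r) (f : Q.RRing) :
    ∃ (m : Q.BasisIndex →₀ ℕ) (g : Q.BRing),
      f * Q.toRRing (MvPolynomial.monomial m 1) = Q.toRRing g := by
  obtain ⟨⟨x, y⟩, e⟩ := IsLocalization.surj Q.SMonoid f
  obtain ⟨m, hm⟩ := Q.exists_monomial_of_mem_SMonoid y.2
  obtain ⟨g, rfl⟩ := Ideal.Quotient.mk_surjective x
  refine ⟨m, g, ?_⟩
  simp only [hm] at e
  exact e

theorem eq_top_of_ratio_mem (Q : FlagMatroid n r) (b₀ : ∀ i, Q.bases i)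
    (L : Subalgebra ℂ Q.coordRing) (h : ∀ i (b : Q.bases i), Q.ratio b (b₀ i) ∈ L)
    (h' : ∀ i (b : Q.bases i), Q.ratio (b₀ i) b ∈ L) : L = ⊤ := by
  rw [eq_top_iff]
  rintro f -
  let ρ : (Q.BasisIndex →₀ ℕ) → Q.coordRing := fun m =>
    m.prod fun x e => Q.ratio ⟨x.1.2, x.2⟩ (b₀ x.1.1) ^ e
  let W : (Fin s → ℕ) → Q.RRing := fun d => ∏ i, Q.coord (b₀ i) ^ d i
  have hW : ∀ d, IsUnit (W d) := fun d =>
    Finset.prod_induction _ IsUnit (fun _ _ => IsUnit.mul) isUnit_one fun i _ =>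
      (Q.isUnit_coord _).pow _
  obtain ⟨m, g, hg⟩ := Q.exists_mul_monomial_eq f
  have hsum : f * ρ m =
      ∑ k ∈ g.support with Q.monomialDegree k = Q.monomialDegree m, g.coeff k • ρ k := by
    apply Subtype.ext
    refine (hW (Q.monomialDegree m)).mul_left_injective ?_
    have hweight : ∀ t, Q.torusAct t (Q.toRRing g) =
        (∏ i, (t i : ℂ) ^ Q.monomialDegree m i) • Q.toRRing g := fun t => by
      rw [← hg, map_mul, f.2 t, torusAct_monomial, mul_smul_comm]
    calc (f * ρ m : Q.coordRing) * W (Q.monomialDegree m)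
        = Q.toRRing g := by rw [← hg, Q.toRRing_monomial b₀, one_smul, ← mul_assoc]; rfl
      _ = ∑ k ∈ g.support with Q.monomialDegree k = Q.monomialDegree m,
            Q.toRRing (MvPolynomial.monomial k (g.coeff k)) := Q.toRRing_eq_sum_of_torusAct hweight
      _ = _ := ?_
    beta_reduce
    rw [AddSubmonoidClass.coe_finsetSum, Finset.sum_mul]
    refine Finset.sum_congr rfl fun k hk => ?_
    rw [← (Finset.mem_filter.mp hk).2, Q.toRRing_monomial b₀]
  have hρ : ρ m * (m.prod fun x e => Q.ratio (b₀ x.1.1) ⟨x.1.2, x.2⟩ ^ e) = 1 := by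
    simp only [ρ, ← Finsupp.prod_mul, ← mul_pow, ratio_mul_ratio, one_pow]
    exact Finset.prod_const_one
  rw [← mul_one f, ← hρ, ← mul_assoc, hsum]
  exact L.mul_mem (L.sum_mem fun k _ => L.smul_mem (L.prod_mem fun x _ => L.pow_mem (h _ _) _) _)
    (L.prod_mem fun x _ => L.pow_mem (h' _ _) _)

instance (Q : FlagMatroid n r) : Algebra.FiniteType ℂ Q.coordRing := by
  choose b hb using Q.bases_nonempty
  let S : Set Q.coordRing := Set.range fun x : Σ i, Q.bases i × Q.bases i => Q.ratio x.2.1 x.2.2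
  have hS : Algebra.adjoin ℂ S = ⊤ := Q.eq_top_of_ratio_mem (fun i => ⟨b i, hb i⟩) _
    (fun _ _ => Algebra.subset_adjoin ⟨⟨_, _, _⟩, rfl⟩)
    fun _ _ => Algebra.subset_adjoin ⟨⟨_, _, _⟩, rfl⟩
  exact ⟨hS ▸ Subalgebra.fg_def.mpr ⟨S, Set.finite_range _, rfl⟩⟩

theorem ratGenerates_ratio (Q : FlagMatroid n r) (b₀ : ∀ i, Q.bases i) :
    RatGenerates ℂ (Set.range fun x : Σ i, Q.bases i => Q.ratio x.2 (b₀ x.1)) := fun L hL hS =>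
  Q.eq_top_of_ratio_mem b₀ L (fun i b => hS ⟨⟨i, b⟩, rfl⟩)
    fun i b => hL _ _ (hS ⟨⟨i, b⟩, rfl⟩) (Q.ratio_mul_ratio _ _)

end TorusInvariants

end FlagMatroid

section SignedMinors

variable {n k : ℕ}

/-- The sign relating the minor on the columns `f`, in the order in which `f` lists them, to the
minor on the same columns in increasing order. -/
noncomputable def columnSign (f : Fin k ↪ Fin n) : ℂ :=
  ((Equiv.Perm.sign (Tuple.sort f) : ℤ) : ℂ)

theorem columnSign_mul_self (f : Fin k ↪ Fin n) : columnSign f * columnSign f = 1 := by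
  rw [columnSign, ← Int.cast_mul, ← Units.val_mul, Int.units_mul_self]
  simp

theorem columnSign_ne_zero (f : Fin k ↪ Fin n) : columnSign f ≠ 0 :=
  left_ne_zero_of_mul_eq_one (columnSign_mul_self f)

theorem initialMinor_eq_det (A : Matrix (Fin n) (Fin n) ℂ) {l : Finset (Fin n)} (hl : l.card = k)
    (hk : k ≤ n) :
    initialMinor A l = (A.submatrix (Fin.castLE hk) (l.orderEmbOfFin hl)).det := by
  subst hl
  rfl

theorem orderEmbOfFin_map_univ (f : Fin k ↪ Fin n) (h : (Finset.univ.map f).card = k) :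
    ⇑((Finset.univ.map f).orderEmbOfFin h) = f ∘ Tuple.sort f :=
  (Finset.orderEmbOfFin_unique h (fun _ => Finset.mem_map_of_mem f (Finset.mem_univ _))
    ((Tuple.monotone_sort f).strictMono_of_injective
      (f.injective.comp (Tuple.sort f).injective))).symm

theorem columnSign_mul_initialMinor (f : Fin k ↪ Fin n) (hk : k ≤ n)
    (A : Matrix (Fin n) (Fin n) ℂ) :
    columnSign f * initialMinor A (Finset.univ.map f) = (A.submatrix (Fin.castLE hk) f).det := by
  rw [initialMinor_eq_det A (by simp) hk, orderEmbOfFin_map_univ,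
    show A.submatrix (Fin.castLE hk) (f ∘ Tuple.sort f) =
      (A.submatrix (Fin.castLE hk) f).submatrix id (Tuple.sort f) from rfl,
    Matrix.det_permute', ← columnSign, ← mul_assoc, columnSign_mul_self, one_mul]

variable {s : ℕ} {r : Fin s → ℕ} {i : Fin s}

/-- The alternating Plücker coordinate of an ordered list of columns. -/
noncomputable def signedPlucker (f : Fin (r i) ↪ Fin n) : MvPolynomial (PluckerIndex n r) ℂ :=
  MvPolynomial.C (columnSign f) * MvPolynomial.X ⟨(i, Finset.univ.map f), by simp⟩

theorem aeval_signedPlucker (f : Fin (r i) ↪ Fin n) (hr : r i ≤ n) {p : PluckerIndex n r → ℂ}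
    {A : Matrix (Fin n) (Fin n) ℂ} {c : Fin s → ℂˣ}
    (hp : ∀ x : PluckerIndex n r, p x = c x.1.1 * initialMinor A x.1.2) :
    MvPolynomial.aeval p (signedPlucker f) = c i * (A.submatrix (Fin.castLE hr) f).det := by
  rw [signedPlucker, map_mul, MvPolynomial.aeval_C, MvPolynomial.aeval_X, hp,
    ← columnSign_mul_initialMinor f, Algebra.algebraMap_self, RingHom.id_apply, mul_left_comm]

end SignedMinors

namespace FlagMatroid

section ChartCoordinates

variable {n s : ℕ} {r : Fin s → ℕ}

open Classical in
/-- The projection of the full polynomial ring to `B_Q` that kills the coordinates of non-bases. -/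
noncomputable def killNonbases (Q : FlagMatroid n r) :
    MvPolynomial (PluckerIndex n r) ℂ →ₐ[ℂ] Q.BRing :=
  MvPolynomial.aeval fun x => if h : x.1.2 ∈ Q.bases x.1.1 then MvPolynomial.X ⟨x.1, h⟩ else 0

theorem killNonbases_X_of_mem (Q : FlagMatroid n r) {x : PluckerIndex n r}
    (h : x.1.2 ∈ Q.bases x.1.1) :
    Q.killNonbases (MvPolynomial.X x) = MvPolynomial.X ⟨x.1, h⟩ := by
  rw [killNonbases, MvPolynomial.aeval_X, dif_pos h]

theorem killNonbases_X_of_notMem (Q : FlagMatroid n r) {x : PluckerIndex n r}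
    (h : x.1.2 ∉ Q.bases x.1.1) : Q.killNonbases (MvPolynomial.X x) = 0 := by
  rw [killNonbases, MvPolynomial.aeval_X, dif_neg h]

theorem mk_rename_killNonbases (Q : FlagMatroid n r) (f : MvPolynomial (PluckerIndex n r) ℂ) :
    Ideal.Quotient.mk Q.bigIdeal (MvPolynomial.rename Q.basisIncl (Q.killNonbases f)) =
      Ideal.Quotient.mk Q.bigIdeal f := by
  suffices h : ((Ideal.Quotient.mkₐ ℂ Q.bigIdeal).comp
      (MvPolynomial.rename Q.basisIncl)).comp Q.killNonbases = Ideal.Quotient.mkₐ ℂ Q.bigIdeal from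
    DFunLike.congr_fun h f
  apply MvPolynomial.algHom_ext
  intro x
  by_cases h : x.1.2 ∈ Q.bases x.1.1
  · simp [Q.killNonbases_X_of_mem h, basisIncl]
  · rw [AlgHom.comp_apply, Q.killNonbases_X_of_notMem h, map_zero]
    have hX : MvPolynomial.X x ∈ Q.bigIdeal :=
      Ideal.mem_sup_right (Ideal.subset_span ⟨x, h, rfl⟩)
    exact (Ideal.Quotient.eq_zero_iff_mem.mpr hX).symm

/-- The restriction to the stratum, or rather to its multicone, of polynomials in all the Plücker
coordinates. -/
noncomputable def pluckerHom (Q : FlagMatroid n r) :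
    MvPolynomial (PluckerIndex n r) ℂ →ₐ[ℂ] Q.RRing :=
  Q.toRRing.comp Q.killNonbases

theorem pluckerHom_eq_zero (Q : FlagMatroid n r) {f : MvPolynomial (PluckerIndex n r) ℂ}
    (hf : f ∈ flagIdeal n r) : Q.pluckerHom f = 0 := by
  refine Q.toRRing_eq_zero ?_
  change MvPolynomial.rename Q.basisIncl (Q.killNonbases f) ∈ Q.bigIdeal
  rw [← Ideal.Quotient.eq_zero_iff_mem, mk_rename_killNonbases, Ideal.Quotient.eq_zero_iff_mem]
  exact Ideal.mem_sup_left hf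

theorem exists_algHom_of_mem_flagCone (Q : FlagMatroid n r) {p : PluckerIndex n r → ℂ}
    (hp : p ∈ flagCone n r) (hQ : ∀ x, p x ≠ 0 ↔ x.1.2 ∈ Q.bases x.1.1) :
    ∃ χ : Q.RRing →ₐ[ℂ] ℂ, ∀ f, χ (Q.pluckerHom f) = MvPolynomial.aeval p f := by
  have hbig : Q.bigIdeal ≤ RingHom.ker (MvPolynomial.aeval p :
      MvPolynomial (PluckerIndex n r) ℂ →ₐ[ℂ] ℂ) := by
    refine sup_le (fun f hf => hf p hp) (Ideal.span_le.mpr ?_)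
    rintro _ ⟨x, hx, rfl⟩
    rw [SetLike.mem_coe, RingHom.mem_ker, MvPolynomial.aeval_X]
    exact not_not.mp (mt (hQ x).mp hx)
  let ev : Q.BRing →ₐ[ℂ] ℂ := (MvPolynomial.aeval p).comp (MvPolynomial.rename Q.basisIncl)
  have hev : ∀ b, ev (MvPolynomial.X b) = p (Q.basisIncl b) := fun b => by
    simp only [ev, AlgHom.comp_apply, MvPolynomial.rename_X, MvPolynomial.aeval_X]
  have hunit : ∀ b, IsUnit (ev (MvPolynomial.X b)) := fun b => hev b ▸ ((hQ _).mpr b.2).isUnit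
  refine ⟨Q.liftR ev (fun f hf => hbig hf) hunit, fun f => ?_⟩
  rw [← AlgHom.comp_apply]
  congr 1
  apply MvPolynomial.algHom_ext
  intro x
  refine (Q.liftR_toRRing ev _ hunit _).trans ?_
  change ev (Q.killNonbases (MvPolynomial.X x)) = _
  rw [MvPolynomial.aeval_X]
  by_cases h : x.1.2 ∈ Q.bases x.1.1
  · rw [Q.killNonbases_X_of_mem h, hev]
    rfl
  · rw [Q.killNonbases_X_of_notMem h, map_zero, not_not.mp (mt (hQ x).mp h)]

variable {i : Fin s}

/-- The alternating Plücker coordinate of an ordered list of columns, restricted to the multicone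
over the stratum. -/
noncomputable def signedCoord (Q : FlagMatroid n r) (f : Fin (r i) ↪ Fin n) : Q.RRing :=
  Q.pluckerHom (signedPlucker f)

theorem signedCoord_of_mem (Q : FlagMatroid n r) {f : Fin (r i) ↪ Fin n}
    (h : Finset.univ.map f ∈ Q.bases i) :
    Q.signedCoord f = columnSign f • Q.coord ⟨Finset.univ.map f, h⟩ := by
  rw [signedCoord, signedPlucker, ← MvPolynomial.smul_eq_C_mul, map_smul, pluckerHom,
    AlgHom.comp_apply, Q.killNonbases_X_of_mem h]
  rfl

theorem signedCoord_of_notMem (Q : FlagMatroid n r) {f : Fin (r i) ↪ Fin n}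
    (h : Finset.univ.map f ∉ Q.bases i) : Q.signedCoord f = 0 := by
  rw [signedCoord, signedPlucker, ← MvPolynomial.smul_eq_C_mul, map_smul, pluckerHom,
    AlgHom.comp_apply, Q.killNonbases_X_of_notMem h, map_zero, smul_zero]

theorem isUnit_signedCoord (Q : FlagMatroid n r) {f : Fin (r i) ↪ Fin n}
    (h : Finset.univ.map f ∈ Q.bases i) : IsUnit (Q.signedCoord f) := by
  rw [Q.signedCoord_of_mem h, Algebra.smul_def]
  exact ((columnSign_ne_zero f).isUnit.map _).mul (Q.isUnit_coord _)

theorem faceHomR_coord {P Q : FlagMatroid n r} (hPQ : P.IsFace Q) (b : P.bases i) :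
    faceHomR hPQ (P.coord b) = Q.coord ⟨b, hPQ.mem_bases b.2⟩ := by
  refine (P.liftR_toRRing _ _ _ _).trans ?_
  rw [AlgHom.comp_apply, inclB, MvPolynomial.rename_X]
  rfl

theorem faceHomR_signedCoord {P Q : FlagMatroid n r} (hPQ : P.IsFace Q) {f : Fin (r i) ↪ Fin n}
    (h : Finset.univ.map f ∈ P.bases i) :
    faceHomR hPQ (P.signedCoord f) = Q.signedCoord f := by
  rw [P.signedCoord_of_mem h, Q.signedCoord_of_mem (hPQ.mem_bases h), map_smul,
    faceHomR_coord]

open Classical in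
/-- The affine coordinate of `f` in the chart where the coordinate of `g` is normalised to `1`: the
quotient of the two alternating coordinates. -/
noncomputable def chartCoord (Q : FlagMatroid n r) {g : Fin (r i) ↪ Fin n}
    (hg : Finset.univ.map g ∈ Q.bases i) (f : Fin (r i) ↪ Fin n) : Q.coordRing :=
  if hf : Finset.univ.map f ∈ Q.bases i then
    (columnSign f * columnSign g) • Q.ratio ⟨_, hf⟩ ⟨_, hg⟩
  else 0

theorem chartCoord_of_notMem (Q : FlagMatroid n r) {g f : Fin (r i) ↪ Fin n}
    (hg : Finset.univ.map g ∈ Q.bases i) (hf : Finset.univ.map f ∉ Q.bases i) :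
    Q.chartCoord hg f = 0 :=
  dif_neg hf

theorem chartCoord_mul_signedCoord (Q : FlagMatroid n r) {g : Fin (r i) ↪ Fin n}
    (hg : Finset.univ.map g ∈ Q.bases i) (f : Fin (r i) ↪ Fin n) :
    Q.chartCoord hg f * Q.signedCoord g = Q.signedCoord f := by
  by_cases hf : Finset.univ.map f ∈ Q.bases i
  · rw [chartCoord, dif_pos hf, Subalgebra.coe_smul, Q.signedCoord_of_mem hg,
      Q.signedCoord_of_mem hf, smul_mul_smul_comm, ratio_mul_coord, mul_assoc,
      columnSign_mul_self, mul_one]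
  · rw [Q.chartCoord_of_notMem hg hf, Q.signedCoord_of_notMem hf, Subalgebra.coe_zero, zero_mul]

theorem ratio_eq_smul_chartCoord (Q : FlagMatroid n r) {g f : Fin (r i) ↪ Fin n}
    (hg : Finset.univ.map g ∈ Q.bases i) (hf : Finset.univ.map f ∈ Q.bases i) :
    Q.ratio ⟨_, hf⟩ ⟨_, hg⟩ = (columnSign f * columnSign g) • Q.chartCoord hg f := by
  rw [chartCoord, dif_pos hf, smul_smul, mul_mul_mul_comm, columnSign_mul_self,
    columnSign_mul_self, one_mul, one_smul]

theorem isUnit_chartCoord (Q : FlagMatroid n r) {g f : Fin (r i) ↪ Fin n}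
    (hg : Finset.univ.map g ∈ Q.bases i) (hf : Finset.univ.map f ∈ Q.bases i) :
    IsUnit (Q.chartCoord hg f) := by
  rw [chartCoord, dif_pos hf, Algebra.smul_def]
  exact (((mul_ne_zero (columnSign_ne_zero f) (columnSign_ne_zero g)).isUnit).map _).mul
    (IsUnit.of_mul_eq_one _ (Q.ratio_mul_ratio _ _))

theorem chartCoord_self (Q : FlagMatroid n r) {g : Fin (r i) ↪ Fin n}
    (hg : Finset.univ.map g ∈ Q.bases i) : Q.chartCoord hg g = 1 :=
  Subtype.ext <| (Q.isUnit_signedCoord hg).mul_left_injective <| by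
    simp only [chartCoord_mul_signedCoord, Subalgebra.coe_one, one_mul]

theorem faceHom_chartCoord {P Q : FlagMatroid n r} (hPQ : P.IsFace Q) {g f : Fin (r i) ↪ Fin n}
    (hg : Finset.univ.map g ∈ P.bases i) (hf : Finset.univ.map f ∈ P.bases i) :
    faceHom hPQ (P.chartCoord hg f) = Q.chartCoord (hPQ.mem_bases hg) f := by
  apply Subtype.ext
  refine (Q.isUnit_signedCoord (hPQ.mem_bases hg)).mul_left_injective ?_
  beta_reduce
  rw [chartCoord_mul_signedCoord, ← faceHomR_signedCoord hPQ hg, ← faceHomR_signedCoord hPQ hf,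
    ← P.chartCoord_mul_signedCoord hg f, map_mul]
  rfl

end ChartCoordinates

end FlagMatroid

/-- Labels of the Plücker coordinates on `ℙ³ × Gr(2, 4) × ℙ³`, for columns numbered `1, …, 4`. -/
inductive PluckerLabel
  | p1 | p2 | p3 | p4 | p12 | p13 | p14 | p23 | p24 | p34 | p123 | p124 | p134 | p234
  deriving DecidableEq

namespace PluckerLabel

instance : Fintype PluckerLabel :=
  ⟨{p1, p2, p3, p4, p12, p13, p14, p23, p24, p34, p123, p124, p134, p234}, fun x => by
    cases x <;> decide⟩

/-- The constituent of a flag matroid to which a label belongs. -/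
def level : PluckerLabel → Fin 3
  | p1 | p2 | p3 | p4 => 0
  | p12 | p13 | p14 | p23 | p24 | p34 => 1
  | p123 | p124 | p134 | p234 => 2

/-- The increasing list of the columns of a label, which are counted from `0` here. -/
def tuple : (l : PluckerLabel) → Fin ((![1, 2, 3] : Fin 3 → ℕ) l.level) → Fin 4
  | p1 => (![0] : Fin 1 → Fin 4)
  | p2 => (![1] : Fin 1 → Fin 4)
  | p3 => (![2] : Fin 1 → Fin 4)
  | p4 => (![3] : Fin 1 → Fin 4)
  | p12 => (![0, 1] : Fin 2 → Fin 4)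
  | p13 => (![0, 2] : Fin 2 → Fin 4)
  | p14 => (![0, 3] : Fin 2 → Fin 4)
  | p23 => (![1, 2] : Fin 2 → Fin 4)
  | p24 => (![1, 3] : Fin 2 → Fin 4)
  | p34 => (![2, 3] : Fin 2 → Fin 4)
  | p123 => (![0, 1, 2] : Fin 3 → Fin 4)
  | p124 => (![0, 1, 3] : Fin 3 → Fin 4)
  | p134 => (![0, 2, 3] : Fin 3 → Fin 4)
  | p234 => (![1, 2, 3] : Fin 3 → Fin 4)

/-- The columns of a label, as an embedding that lists them in increasing order. -/
def columns (l : PluckerLabel) : Fin ((![1, 2, 3] : Fin 3 → ℕ) l.level) ↪ Fin 4 :=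
  ⟨l.tuple, by cases l <;> decide⟩

theorem exists_map_columns_eq (i : Fin 3) (S : Finset (Fin 4))
    (hS : S.card = (![1, 2, 3] : Fin 3 → ℕ) i) :
    ∃ l : PluckerLabel, l.level = i ∧ Finset.univ.map l.columns = S := by
  revert i S
  decide

/-- The columns of a label after renaming by a permutation. -/
def columnsVia (σ : Equiv.Perm (Fin 4)) (l : PluckerLabel) :
    Fin ((![1, 2, 3] : Fin 3 → ℕ) l.level) ↪ Fin 4 :=
  l.columns.trans σ.toEmbedding

theorem exists_map_columnsVia_eq (σ : Equiv.Perm (Fin 4)) (i : Fin 3) (S : Finset (Fin 4))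
    (hS : S.card = (![1, 2, 3] : Fin 3 → ℕ) i) :
    ∃ l : PluckerLabel, l.level = i ∧ Finset.univ.map (l.columnsVia σ) = S := by
  obtain ⟨l, hl, hlS⟩ := exists_map_columns_eq i (S.map σ.symm.toEmbedding)
    ((Finset.card_map _).trans hS)
  refine ⟨l, hl, ?_⟩
  rw [columnsVia, ← Finset.map_map, hlS, Finset.map_map]
  simp

theorem rank_le (i : Fin 3) : (![1, 2, 3] : Fin 3 → ℕ) i ≤ 4 := by
  revert i
  decide

/-- The columns that span the `i`-th step of the standard flag after renaming by `σ`. -/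
def initialColumnsVia (σ : Equiv.Perm (Fin 4)) (i : Fin 3) :
    Fin ((![1, 2, 3] : Fin 3 → ℕ) i) ↪ Fin 4 :=
  (Fin.castLEEmb (rank_le i)).trans σ.toEmbedding

theorem initialColumnsVia_zero (σ : Equiv.Perm (Fin 4)) :
    initialColumnsVia σ 0 = columnsVia σ p1 := by
  ext (j : Fin 1)
  fin_cases j
  rfl

theorem initialColumnsVia_one (σ : Equiv.Perm (Fin 4)) :
    initialColumnsVia σ 1 = columnsVia σ p12 := by
  ext (j : Fin 2)
  fin_cases j <;> rfl

theorem initialColumnsVia_two (σ : Equiv.Perm (Fin 4)) :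
    initialColumnsVia σ 2 = columnsVia σ p123 := by
  ext (j : Fin 3)
  fin_cases j <;> rfl

section Minors

variable {A : Type*} [CommRing A]

/-- The minor on the first two rows and the columns `a`, `b`. -/
def minorTwo (M : Matrix (Fin 4) (Fin 4) A) (a b : Fin 4) : A :=
  M 0 a * M 1 b - M 0 b * M 1 a

/-- The minor on the first three rows and the columns `a`, `b`, `c`. -/
def minorThree (M : Matrix (Fin 4) (Fin 4) A) (a b c : Fin 4) : A :=
  M 0 a * M 1 b * M 2 c - M 0 a * M 1 c * M 2 b - M 0 b * M 1 a * M 2 c +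
    M 0 b * M 1 c * M 2 a + M 0 c * M 1 a * M 2 b - M 0 c * M 1 b * M 2 a

/-- The minor on the first rows and the columns of a label, written out. -/
def minor (M : Matrix (Fin 4) (Fin 4) A) : PluckerLabel → A
  | p1 => M 0 0
  | p2 => M 0 1
  | p3 => M 0 2
  | p4 => M 0 3
  | p12 => minorTwo M 0 1
  | p13 => minorTwo M 0 2
  | p14 => minorTwo M 0 3
  | p23 => minorTwo M 1 2
  | p24 => minorTwo M 1 3
  | p34 => minorTwo M 2 3
  | p123 => minorThree M 0 1 2
  | p124 => minorThree M 0 1 3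
  | p134 => minorThree M 0 2 3
  | p234 => minorThree M 1 2 3

theorem det_submatrix_columns (M : Matrix (Fin 4) (Fin 4) A) (l : PluckerLabel)
    (h : (![1, 2, 3] : Fin 3 → ℕ) l.level ≤ 4) :
    (M.submatrix (Fin.castLE h) l.columns).det = minor M l := by
  cases l
  case p1 | p2 | p3 | p4 => exact Matrix.det_fin_one _
  case p12 | p13 | p14 | p23 | p24 | p34 => exact Matrix.det_fin_two _
  case p123 | p124 | p134 | p234 => exact Matrix.det_fin_three _

end Minors

/-- The Plücker coordinate of a label after renaming the columns by `σ`, alternating in the order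
of the renamed columns. -/
noncomputable def plucker (σ : Equiv.Perm (Fin 4)) (l : PluckerLabel) :
    MvPolynomial (PluckerIndex 4 ![1, 2, 3]) ℂ :=
  signedPlucker (i := l.level) (l.columnsVia σ)

theorem aeval_plucker (σ : Equiv.Perm (Fin 4)) (l : PluckerLabel)
    {p : PluckerIndex 4 ![1, 2, 3] → ℂ} {A : Matrix (Fin 4) (Fin 4) ℂ} {c : Fin 3 → ℂˣ}
    (hp : ∀ x : PluckerIndex 4 ![1, 2, 3], p x = c x.1.1 * initialMinor A x.1.2) :
    MvPolynomial.aeval p (plucker σ l) = c l.level * l.minor (A.submatrix id σ) := by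
  rw [plucker, aeval_signedPlucker _ (rank_le _) hp, ← det_submatrix_columns _ _ (rank_le _)]
  rfl

theorem plucker_relations (σ : Equiv.Perm (Fin 4)) :
    plucker σ p1 * plucker σ p23 -
        (plucker σ p2 * plucker σ p13 - plucker σ p3 * plucker σ p12) ∈ flagIdeal 4 ![1, 2, 3] ∧
      plucker σ p1 * plucker σ p24 -
        (plucker σ p2 * plucker σ p14 - plucker σ p4 * plucker σ p12) ∈ flagIdeal 4 ![1, 2, 3] ∧
      plucker σ p1 * plucker σ p34 -
        (plucker σ p3 * plucker σ p14 - plucker σ p4 * plucker σ p13) ∈ flagIdeal 4 ![1, 2, 3] ∧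
      plucker σ p12 * plucker σ p134 -
        (plucker σ p13 * plucker σ p124 - plucker σ p14 * plucker σ p123) ∈
          flagIdeal 4 ![1, 2, 3] ∧
      plucker σ p1 * plucker σ p234 -
        (plucker σ p2 * plucker σ p134 - plucker σ p3 * plucker σ p124 +
          plucker σ p4 * plucker σ p123) ∈ flagIdeal 4 ![1, 2, 3] := by
  refine ⟨?_, ?_, ?_, ?_, ?_⟩ <;> rintro p ⟨A, -, c, hp⟩ <;>
    simp only [map_sub, map_add, map_mul, aeval_plucker σ _ hp, level, minor, minorTwo,
      minorThree] <;> ring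

end PluckerLabel

/-- Names for the affine coordinates on the chart of the flag variety of `ℂ⁴` around the standard
flag; the letters `x`, `u`, `w` stand for the three rows of the unipotent matrix
`ChartCoord.matrix`. -/
inductive ChartCoord
  | x2 | x3 | x4 | u3 | u4 | w4
  deriving DecidableEq

namespace ChartCoord

open PluckerLabel in
/-- The Plücker coordinate that is used as an affine coordinate. -/
def label : ChartCoord → PluckerLabel
  | x2 => p2
  | x3 => p3
  | x4 => p4
  | u3 => p13
  | u4 => p14
  | w4 => p124

variable {A : Type*} [CommRing A]

/-- A matrix whose rows span the flag with given affine coordinates. -/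
def matrix (x : ChartCoord → A) : Matrix (Fin 4) (Fin 4) A :=
  !![1, x x2, x x3, x x4; 0, 1, x u3, x u4; 0, 0, 1, x w4; 0, 0, 0, 1]

/-- The Plücker coordinates of the flag with given affine coordinates. -/
def plucker (x : ChartCoord → A) : PluckerLabel → A
  | .p1 => 1
  | .p2 => x x2
  | .p3 => x x3
  | .p4 => x x4
  | .p12 => 1
  | .p13 => x u3
  | .p14 => x u4
  | .p23 => x x2 * x u3 - x x3
  | .p24 => x x2 * x u4 - x x4
  | .p34 => x x3 * x u4 - x x4 * x u3
  | .p123 => 1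
  | .p124 => x w4
  | .p134 => x u3 * x w4 - x u4
  | .p234 => x x2 * (x u3 * x w4 - x u4) - x x3 * x w4 + x x4

theorem plucker_label (x : ChartCoord → A) (i : ChartCoord) : plucker x i.label = x i := by
  cases i <;> rfl

theorem exists_plucker_eq_one (i : Fin 3) : ∃ l : PluckerLabel, l.level = i ∧
    ∀ {A : Type} [CommRing A] (x : ChartCoord → A), plucker x l = 1 := by
  fin_cases i
  exacts [⟨.p1, rfl, fun _ => rfl⟩, ⟨.p12, rfl, fun _ => rfl⟩, ⟨.p123, rfl, fun _ => rfl⟩]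

theorem minor_matrix (x : ChartCoord → A) (l : PluckerLabel) :
    l.minor (matrix x) = plucker x l := by
  cases l <;>
    simp [PluckerLabel.minor, PluckerLabel.minorTwo, PluckerLabel.minorThree, matrix, plucker]
  all_goals ring

theorem det_matrix (x : ChartCoord → A) : (matrix x).det = 1 := by
  rw [Matrix.det_of_isUpperTriangular]
  · simp [Fin.prod_univ_four, matrix]
  · intro i j h
    fin_cases i <;> fin_cases j <;> first | rfl | exact absurd h (by decide)

end ChartCoord

namespace FlagMatroid

section Charts

open PluckerLabel

/-- The label `l` is a basis of its constituent after renaming the columns by `σ`. -/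
def Has (Q : FlagMatroid 4 ![1, 2, 3]) (σ : Equiv.Perm (Fin 4)) (l : PluckerLabel) : Prop :=
  Finset.univ.map (l.columnsVia σ) ∈ Q.bases l.level

theorem Has.mono {P Q : FlagMatroid 4 ![1, 2, 3]} {σ : Equiv.Perm (Fin 4)} (hPQ : P.IsFace Q)
    {l : PluckerLabel} (h : P.Has σ l) : Q.Has σ l :=
  hPQ.mem_bases h

/-- The standard flag is a flag of bases after renaming the columns by `σ`, so that the flags in the
stratum lie in the affine chart around the renamed standard flag. -/
def IsChart (Q : FlagMatroid 4 ![1, 2, 3]) (σ : Equiv.Perm (Fin 4)) : Prop :=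
  ∀ i, Finset.univ.map (initialColumnsVia σ i) ∈ Q.bases i

theorem IsChart.mono {P Q : FlagMatroid 4 ![1, 2, 3]} {σ : Equiv.Perm (Fin 4)} (hPQ : P.IsFace Q)
    (h : P.IsChart σ) : Q.IsChart σ :=
  fun i => hPQ.mem_bases (h i)

variable (Q : FlagMatroid 4 ![1, 2, 3]) {σ : Equiv.Perm (Fin 4)}

theorem isChart_iff : Q.IsChart σ ↔ Q.Has σ p1 ∧ Q.Has σ p12 ∧ Q.Has σ p123 := by
  simp only [IsChart, Fin.forall_fin_succ, IsEmpty.forall_iff, and_true]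
  exact and_congr (iff_of_eq (congrArg (Finset.univ.map · ∈ Q.bases 0) (initialColumnsVia_zero σ)))
    (and_congr (iff_of_eq (congrArg (Finset.univ.map · ∈ Q.bases 1) (initialColumnsVia_one σ)))
      (iff_of_eq (congrArg (Finset.univ.map · ∈ Q.bases 2) (initialColumnsVia_two σ))))

/-- The normalised Plücker coordinates in the chart `σ`, as functions on the stratum. -/
noncomputable def chartPlucker (hσ : Q.IsChart σ) (l : PluckerLabel) : Q.coordRing :=
  Q.chartCoord (hσ l.level) (l.columnsVia σ)

theorem chartPlucker_p1 (hσ : Q.IsChart σ) : Q.chartPlucker hσ p1 = 1 :=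
  (congrArg (Q.chartCoord (hσ 0)) (initialColumnsVia_zero σ).symm).trans (Q.chartCoord_self (hσ 0))

theorem chartPlucker_p12 (hσ : Q.IsChart σ) : Q.chartPlucker hσ p12 = 1 :=
  (congrArg (Q.chartCoord (hσ 1)) (initialColumnsVia_one σ).symm).trans (Q.chartCoord_self (hσ 1))

theorem chartPlucker_p123 (hσ : Q.IsChart σ) : Q.chartPlucker hσ p123 = 1 :=
  (congrArg (Q.chartCoord (hσ 2)) (initialColumnsVia_two σ).symm).trans (Q.chartCoord_self (hσ 2))

theorem isUnit_chartPlucker (hσ : Q.IsChart σ) {l : PluckerLabel} (h : Q.Has σ l) :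
    IsUnit (Q.chartPlucker hσ l) :=
  Q.isUnit_chartCoord (hσ l.level) h

theorem chartPlucker_eq_zero (hσ : Q.IsChart σ) {l : PluckerLabel} (h : ¬ Q.Has σ l) :
    Q.chartPlucker hσ l = 0 :=
  Q.chartCoord_of_notMem (hσ l.level) h

theorem faceHom_chartPlucker {P Q : FlagMatroid 4 ![1, 2, 3]} (hPQ : P.IsFace Q)
    (hσ : P.IsChart σ) {l : PluckerLabel} (h : P.Has σ l) :
    faceHom hPQ (P.chartPlucker hσ l) = Q.chartPlucker (hσ.mono hPQ) l :=
  faceHom_chartCoord hPQ (hσ l.level) h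

theorem pluckerHom_plucker (hσ : Q.IsChart σ) (l : PluckerLabel) :
    Q.pluckerHom (plucker σ l) =
      Q.chartPlucker hσ l * Q.signedCoord (initialColumnsVia σ l.level) :=
  (Q.chartCoord_mul_signedCoord (hσ l.level) (l.columnsVia σ)).symm

theorem chartPlucker_relations (hσ : Q.IsChart σ) :
    Q.chartPlucker hσ p23 =
        Q.chartPlucker hσ p2 * Q.chartPlucker hσ p13 - Q.chartPlucker hσ p3 ∧
      Q.chartPlucker hσ p24 =
        Q.chartPlucker hσ p2 * Q.chartPlucker hσ p14 - Q.chartPlucker hσ p4 ∧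
      Q.chartPlucker hσ p34 = Q.chartPlucker hσ p3 * Q.chartPlucker hσ p14 -
        Q.chartPlucker hσ p4 * Q.chartPlucker hσ p13 ∧
      Q.chartPlucker hσ p134 =
        Q.chartPlucker hσ p13 * Q.chartPlucker hσ p124 - Q.chartPlucker hσ p14 ∧
      Q.chartPlucker hσ p234 = Q.chartPlucker hσ p2 * Q.chartPlucker hσ p134 -
        Q.chartPlucker hσ p3 * Q.chartPlucker hσ p124 + Q.chartPlucker hσ p4 := by
  have cancel {i j : Fin 3} {a b : Q.coordRing}
      (h : (a : Q.RRing) * (Q.signedCoord (initialColumnsVia σ i) *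
          Q.signedCoord (initialColumnsVia σ j)) =
        b * (Q.signedCoord (initialColumnsVia σ i) * Q.signedCoord (initialColumnsVia σ j))) :
      a = b :=
    Subtype.ext (((Q.isUnit_signedCoord (hσ i)).mul
      (Q.isUnit_signedCoord (hσ j))).mul_left_injective h)
  obtain ⟨h23, h24, h34, h134, h234⟩ := plucker_relations σ
  replace h23 := Q.pluckerHom_eq_zero h23
  replace h24 := Q.pluckerHom_eq_zero h24
  replace h34 := Q.pluckerHom_eq_zero h34
  replace h134 := Q.pluckerHom_eq_zero h134
  replace h234 := Q.pluckerHom_eq_zero h234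
  simp only [map_sub, map_add, map_mul, Q.pluckerHom_plucker hσ, level, chartPlucker_p1,
    chartPlucker_p12, chartPlucker_p123, Subalgebra.coe_one, one_mul] at h23 h24 h34 h134 h234
  refine ⟨cancel (i := 0) (j := 1) ?_, cancel (i := 0) (j := 1) ?_, cancel (i := 0) (j := 1) ?_,
    cancel (i := 1) (j := 2) ?_, cancel (i := 0) (j := 2) ?_⟩ <;>
    simp only [Subalgebra.coe_sub, Subalgebra.coe_add, Subalgebra.coe_mul]
  · linear_combination h23
  · linear_combination h24
  · linear_combination h34
  · linear_combination h134
  · linear_combination h234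

theorem chartPlucker_eq_plucker (hσ : Q.IsChart σ) (l : PluckerLabel) :
    Q.chartPlucker hσ l = ChartCoord.plucker (fun i => Q.chartPlucker hσ i.label) l := by
  obtain ⟨h23, h24, h34, h134, h234⟩ := Q.chartPlucker_relations hσ
  cases l
  case p1 => exact Q.chartPlucker_p1 hσ
  case p12 => exact Q.chartPlucker_p12 hσ
  case p123 => exact Q.chartPlucker_p123 hσ
  case p2 | p3 | p4 | p13 | p14 | p124 => rfl
  case p23 => exact h23
  case p24 => exact h24
  case p34 => exact h34
  case p134 => exact h134
  case p234 => rw [h234, h134]; rfl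

theorem ratGenerates_chartPlucker (hσ : Q.IsChart σ) :
    RatGenerates ℂ (Set.range fun i : ChartCoord => Q.chartPlucker hσ i.label) := by
  intro L hL hS
  have coord_mem (i : ChartCoord) : Q.chartPlucker hσ i.label ∈ L := hS ⟨i, rfl⟩
  have plucker_mem (l) : Q.chartPlucker hσ l ∈ L := by
    rw [chartPlucker_eq_plucker]
    cases l <;> simp only [ChartCoord.plucker] <;>
      repeat' first
        | exact coord_mem _
        | exact L.one_mem
        | apply L.sub_mem
        | apply L.add_mem
        | apply L.mul_mem
  refine Q.ratGenerates_ratio (fun i => ⟨_, hσ i⟩) L hL ?_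
  rintro _ ⟨⟨i, S, hS⟩, rfl⟩
  obtain ⟨l, rfl, rfl⟩ := exists_map_columnsVia_eq σ i S (Q.card_of_mem_bases hS)
  change Q.ratio ⟨_, hS⟩ ⟨_, hσ l.level⟩ ∈ L
  rw [Q.ratio_eq_smul_chartCoord (hσ l.level) hS]
  exact L.smul_mem (plucker_mem l) _

/-- The flag with affine coordinates `x` in the chart of `σ`. -/
def chartMatrix (σ : Equiv.Perm (Fin 4)) (x : ChartCoord → ℂ) : Matrix (Fin 4) (Fin 4) ℂ :=
  (ChartCoord.matrix x).submatrix id σ.symm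

theorem chartMatrix_submatrix (σ : Equiv.Perm (Fin 4)) (x : ChartCoord → ℂ) :
    (chartMatrix σ x).submatrix id σ = ChartCoord.matrix x := by
  ext i j
  simp [chartMatrix]

theorem det_chartMatrix_ne_zero (σ : Equiv.Perm (Fin 4)) (x : ChartCoord → ℂ) :
    (chartMatrix σ x).det ≠ 0 := by
  have h : ((chartMatrix σ x).submatrix id σ).det = 1 := by
    rw [chartMatrix_submatrix, ChartCoord.det_matrix]
  rw [Matrix.det_permute'] at h
  exact right_ne_zero_of_mul_eq_one h

theorem columnSign_mul_initialMinor_chartMatrix (σ : Equiv.Perm (Fin 4)) (x : ChartCoord → ℂ)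
    (l : PluckerLabel) :
    columnSign (l.columnsVia σ) *
      initialMinor (chartMatrix σ x) (Finset.univ.map (l.columnsVia σ)) =
        ChartCoord.plucker x l := by
  rw [columnSign_mul_initialMinor _ (rank_le _), ← ChartCoord.minor_matrix,
    ← chartMatrix_submatrix σ x, ← det_submatrix_columns _ _ (rank_le _)]
  rfl

theorem exists_algHom_chartPlucker (hσ : Q.IsChart σ) (x : ChartCoord → ℂ)
    (hx : ∀ l, ChartCoord.plucker x l ≠ 0 ↔ Q.Has σ l) :
    ∃ χ : Q.coordRing →ₐ[ℂ] ℂ, ∀ i : ChartCoord, χ (Q.chartPlucker hσ i.label) = x i := by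
  let p : PluckerIndex 4 ![1, 2, 3] → ℂ := fun y => initialMinor (chartMatrix σ x) y.1.2
  have p_eq (y : PluckerIndex 4 ![1, 2, 3]) :
      p y = ((1 : Fin 3 → ℂˣ) y.1.1 : ℂ) * initialMinor (chartMatrix σ x) y.1.2 := by
    simp [p]
  have p_ne_zero (y : PluckerIndex 4 ![1, 2, 3]) : p y ≠ 0 ↔ y.1.2 ∈ Q.bases y.1.1 := by
    obtain ⟨⟨i, S⟩, hS⟩ := y
    obtain ⟨l, rfl, rfl⟩ := exists_map_columnsVia_eq σ i S hS
    refine Iff.trans ?_ (hx l)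
    rw [← columnSign_mul_initialMinor_chartMatrix σ x l]
    simp only [p, mul_ne_zero_iff, columnSign_ne_zero, ne_eq, not_false_eq_true, true_and]
  obtain ⟨χ, hχ⟩ := Q.exists_algHom_of_mem_flagCone
    ⟨chartMatrix σ x, det_chartMatrix_ne_zero σ x, 1, p_eq⟩ p_ne_zero
  have χ_plucker (l) : χ (Q.pluckerHom (plucker σ l)) = ChartCoord.plucker x l := by
    rw [hχ, aeval_plucker σ l p_eq, chartMatrix_submatrix, ChartCoord.minor_matrix, Pi.one_apply,
      Units.val_one, one_mul]
  have χ_initial (i) : χ (Q.signedCoord (initialColumnsVia σ i)) = 1 := by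
    obtain ⟨l, rfl, hl⟩ := ChartCoord.exists_plucker_eq_one i
    rw [← hl x, ← χ_plucker, Q.pluckerHom_plucker hσ, Q.chartPlucker_eq_plucker hσ l, hl,
      Subalgebra.coe_one, one_mul]
  refine ⟨χ.comp Q.coordRing.val, fun i => ?_⟩
  have h := χ_plucker i.label
  rw [Q.pluckerHom_plucker hσ, map_mul, χ_initial, mul_one, ChartCoord.plucker_label] at h
  exact h

end Charts

end FlagMatroid

section VanishingPatterns

/-- Not exactly one of three statements holds. This is how the nonvanishing of three numbers with
zero sum can look. -/
def NotExactlyOne (a b c : Prop) : Prop :=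
  (a → b ∨ c) ∧ (b → a ∨ c) ∧ (c → a ∨ b)

theorem NotExactlyOne.iff_of_not {a b c : Prop} (h : NotExactlyOne a b c) (ha : ¬ a) : b ↔ c :=
  ⟨fun hb => (h.2.1 hb).resolve_left ha, fun hc => (h.2.2 hc).resolve_left ha⟩

theorem exists_three_term {a b c d : Prop} (h : NotExactlyOne (a ∧ b) c d) {s t w : ℂ} (hs : s ≠ 0)
    (ht : t ≠ 0) (hw : w ≠ 0) (hstw : s * t - w ≠ 0) :
    ∃ x y z : ℂ, (x ≠ 0 ↔ a) ∧ (y ≠ 0 ↔ b) ∧ (z ≠ 0 ↔ c) ∧ (x * y - z ≠ 0 ↔ d) ∧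
      (a → x = s) ∧ (b ∧ ¬(a ∧ ¬d) → y = t) ∧ (c → z = w) ∧
      (x = 0 ∨ x = s) ∧ (z = 0 ∨ z = w) ∧ (y = 0 ∨ y = t ∨ x ≠ 0 ∧ x * y = z) := by
  obtain ⟨h1, h2, h3⟩ := h
  by_cases ha : a <;> by_cases hb : b <;> by_cases hc : c <;> by_cases hd : d <;>
    simp only [ha, hb, hc, hd, and_true, and_false, true_and, or_false, or_true, forall_const,
      imp_false, not_true_eq_false, not_false_eq_true, IsEmpty.forall_iff] at h1 h2 h3 ⊢
  · exact ⟨s, t, w, by simp [*]⟩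
  · exact ⟨s, w / s, w, by simp [*, mul_div_cancel₀]⟩
  · exact ⟨s, t, 0, by simp [*]⟩
  · exact ⟨s, 0, w, by simp [*]⟩
  · exact ⟨s, 0, 0, by simp [*]⟩
  · exact ⟨0, t, w, by simp [*]⟩
  · exact ⟨0, t, 0, by simp [*]⟩
  · exact ⟨0, 0, w, by simp [*]⟩
  · exact ⟨0, 0, 0, by simp [*]⟩

/-- The variant of `exists_three_term` in which `z` rather than `y` is solved for when
`x * y = z` is forced. -/
theorem exists_three_term' {a b c d : Prop} (h : NotExactlyOne (a ∧ b) c d) {s t w : ℂ} (hs : s ≠ 0)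
    (ht : t ≠ 0) (hw : w ≠ 0) (hstw : s * t - w ≠ 0) :
    ∃ x y z : ℂ, (x ≠ 0 ↔ a) ∧ (y ≠ 0 ↔ b) ∧ (z ≠ 0 ↔ c) ∧ (x * y - z ≠ 0 ↔ d) ∧
      (b → y = t) ∧ (a → x = s) ∧ (c ∧ ¬(a ∧ b ∧ ¬d) → z = w) ∧
      (x = 0 ∨ x = s) ∧ (z = 0 ∨ z = w ∨ x * y = z) := by
  obtain ⟨h1, h2, h3⟩ := h
  by_cases ha : a <;> by_cases hb : b <;> by_cases hc : c <;> by_cases hd : d <;>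
    simp only [ha, hb, hc, hd, and_true, and_false, true_and, or_false, or_true, forall_const,
      imp_false, not_true_eq_false, not_false_eq_true, IsEmpty.forall_iff] at h1 h2 h3 ⊢
  · exact ⟨s, t, w, by simp [*]⟩
  · exact ⟨s, t, s * t, by simp [*]⟩
  · exact ⟨s, t, 0, by simp [*]⟩
  · exact ⟨s, 0, w, by simp [*]⟩
  · exact ⟨s, 0, 0, by simp [*]⟩
  · exact ⟨0, t, w, by simp [*]⟩
  · exact ⟨0, t, 0, by simp [*]⟩
  · exact ⟨0, 0, w, by simp [*]⟩
  · exact ⟨0, 0, 0, by simp [*]⟩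

/-- On the affine line the forms `x`, `p * s - x` and `x * r - q * s` vanish at `0`, `p * s` and
`q * s / r`; the three hypotheses of type `NotExactlyOne` say which of these points coincide. -/
theorem exists_point_on_line {b e f : Prop} {p q r : ℂ} (h1 : NotExactlyOne (p ≠ 0) b e)
    (h2 : NotExactlyOne (b ∧ r ≠ 0) (q ≠ 0) f) (h3 : NotExactlyOne (p * r - q ≠ 0) (r ≠ 0 ∧ e) f)
    {s t : ℂ} (hs : s ≠ 0) (ht : t ≠ 0) (hst : p * s - t ≠ 0)
    (hqr : q ≠ 0 ∨ r ≠ 0 → t * r - q * s ≠ 0) :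
    ∃ x : ℂ, (x ≠ 0 ↔ b) ∧ (p * s - x ≠ 0 ↔ e) ∧ (x * r - q * s ≠ 0 ↔ f) ∧
      (b ∧ e ∧ ¬(¬f ∧ r ≠ 0) → x = t) := by
  obtain ⟨h11, h12, h13⟩ := h1
  obtain ⟨h21, h22, h23⟩ := h2
  obtain ⟨h31, h32, h33⟩ := h3
  by_cases he : e
  · by_cases hfr : ¬f ∧ r ≠ 0
    · obtain ⟨hf, hr⟩ := hfr
      have hdet : p * r - q ≠ 0 := by grind
      have hbq : q ≠ 0 ↔ b := by grind
      refine ⟨q * s / r, by simp [← hbq, hr, hs], ?_, ?_, by grind⟩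
      · rw [show p * s - q * s / r = (p * r - q) * s / r by field_simp]
        simp [*]
      · simp [hf, div_mul_cancel₀ _ hr]
    · by_cases hb : b
      · refine ⟨t, by simp [hb, ht], by simp [he, hst], ?_, fun _ => rfl⟩
        by_cases hf : f
        · exact iff_of_true (hqr (by grind)) hf
        · have hr : r = 0 := by grind
          have hq : q = 0 := by grind
          simp [hf, hr, hq]
      · have hqf : q ≠ 0 ↔ f := by grind
        have hp : p ≠ 0 := by grind
        exact ⟨0, by simp [hb], by simp [*], by simp [← hqf, hs], by grind⟩
  · have hp : p ≠ 0 ↔ b := by grind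
    have hdet : p * r - q ≠ 0 ↔ f := by grind
    refine ⟨p * s, by simp [← hp, hs], by simp [he], ?_, by grind⟩
    rw [show p * s * r - q * s = (p * r - q) * s by ring, mul_ne_zero_iff, hdet]
    simp [hs]

theorem exists_two_forms {a b e f : Prop} {p q r : ℂ} (h1 : NotExactlyOne (p ≠ 0 ∧ a) b e)
    (h2 : NotExactlyOne (b ∧ r ≠ 0) (q ≠ 0 ∧ a) f)
    (h3 : NotExactlyOne (a ∧ p * r - q ≠ 0) (r ≠ 0 ∧ e) f) {s t : ℂ} (hs : s ≠ 0) (ht : t ≠ 0)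
    (hst : p * s - t ≠ 0) (hqr : q ≠ 0 ∨ r ≠ 0 → t * r - q * s ≠ 0) :
    ∃ u x : ℂ, (u ≠ 0 ↔ a) ∧ (x ≠ 0 ↔ b) ∧ (p * u - x ≠ 0 ↔ e) ∧ (x * r - q * u ≠ 0 ↔ f) ∧
      (a → u = s) ∧ (b ∧ ¬(a ∧ ¬e) ∧ ¬(a ∧ ¬f ∧ r ≠ 0) → x = t) := by
  by_cases ha : a
  · simp only [ha, and_true, true_and] at h1 h2 h3
    obtain ⟨x, hb, he, hf, hx⟩ := exists_point_on_line h1 h2 h3 hs ht hst hqr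
    exact ⟨s, x, by simp [ha, hs], hb, he, hf, fun _ => rfl, by grind⟩
  · have hbe : b ↔ e := h1.iff_of_not (by tauto)
    have hbf : b ∧ r ≠ 0 ↔ f := by obtain ⟨h21, -, h23⟩ := h2; tauto
    by_cases hb : b
    · exact ⟨0, t, by simp [ha], by simp [hb, ht], by simp [← hbe, hb, ht],
        by simp [← hbf, hb, ht], by tauto, fun _ => rfl⟩
    · exact ⟨0, 0, by simp [ha], by simp [hb], by simp [← hbe, hb], by simp [← hbf, hb], by tauto,
        by tauto⟩

/-- The eight forms are the entries and maximal minors of the matrix with rows `1, x, v, z` and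
`0, 1, u, y`, which is built up column by column. -/
theorem exists_two_rows {a b c d a' b' e f : Prop} (h0 : NotExactlyOne (a ∧ b) c d)
    (h1 : NotExactlyOne (a ∧ a') b' e) (h2 : NotExactlyOne (b' ∧ b) (c ∧ a') f)
    (h3 : NotExactlyOne (a' ∧ d) (b ∧ e) f) {s t w s' t' : ℂ} (hs : s ≠ 0) (ht : t ≠ 0)
    (hw : w ≠ 0) (hs' : s' ≠ 0) (ht' : t' ≠ 0) (hstw : s * t - w ≠ 0) (hst : s * s' - t' ≠ 0)
    (htw : t' * t - w * s' ≠ 0) :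
    ∃ x y z u v : ℂ, (x ≠ 0 ↔ a) ∧ (y ≠ 0 ↔ b) ∧ (z ≠ 0 ↔ c) ∧ (x * y - z ≠ 0 ↔ d) ∧
      (u ≠ 0 ↔ a') ∧ (v ≠ 0 ↔ b') ∧ (x * u - v ≠ 0 ↔ e) ∧ (v * y - z * u ≠ 0 ↔ f) ∧
      (a → x = s) ∧ (b ∧ ¬(a ∧ ¬d) → y = t) ∧ (c → z = w) ∧ (a' → u = s') ∧
      (b' ∧ ¬(a' ∧ ¬e) ∧ ¬(a' ∧ ¬f ∧ b) → v = t') := by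
  obtain ⟨x, y, z, hx, hy, hz, hd, ex, ey, ez, x_eq, z_eq, y_eq⟩ :=
    exists_three_term h0 hs ht hw hstw
  have hxt : x * s' - t' ≠ 0 := by
    rcases x_eq with rfl | rfl
    · simpa using ht'
    · exact hst
  have hzy : z ≠ 0 ∨ y ≠ 0 → t' * y - z * s' ≠ 0 := by
    rcases y_eq with rfl | rfl | ⟨-, rfl⟩
    · intro h
      simpa [hs'] using h
    · rcases z_eq with rfl | rfl
      · simp [ht, ht']
      · exact fun _ => htw
    · intro h
      have hy0 : y ≠ 0 := by rintro rfl; simp at h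
      rw [show t' * y - x * y * s' = -y * (x * s' - t') by ring]
      exact mul_ne_zero (neg_ne_zero.mpr hy0) hxt
  obtain ⟨u, v, hu, hv, he, hf, eu, ev⟩ := exists_two_forms (p := x) (q := z) (r := y)
    (by rwa [hx]) (by rwa [hy, hz]) (by rwa [hd, hy]) hs' ht' hxt hzy
  rw [hy] at ev
  exact ⟨x, y, z, u, v, hx, hy, hz, hd, hu, hv, he, hf, ex, ey, ez, eu, ev⟩

end VanishingPatterns

section CoordinateSystems

open PluckerLabel ChartCoord

/-- The conditions on the set of nonvanishing Plücker coordinates in a chart that the exchange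
property of flag matroids imposes. Each `rel` field is the trace of a three-term Plücker relation,
except `rel_p234`, which comes from the relation with four terms. -/
structure IsFlagPattern (h : PluckerLabel → Prop) : Prop where
  has_p1 : h p1
  has_p12 : h p12
  has_p123 : h p123
  rel_p23 : NotExactlyOne (h p2 ∧ h p13) (h p3) (h p23)
  rel_p24 : NotExactlyOne (h p2 ∧ h p14) (h p4) (h p24)
  rel_p34 : NotExactlyOne (h p3 ∧ h p14) (h p4 ∧ h p13) (h p34)
  rel_p34' : NotExactlyOne (h p13 ∧ h p24) (h p14 ∧ h p23) (h p34)
  rel_p134 : NotExactlyOne (h p124 ∧ h p13) (h p14) (h p134)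
  rel_line2 : NotExactlyOne (h p23 ∧ h p124) (h p24) (h p234)
  rel_line3 : NotExactlyOne (h p13 ∧ h p234) (h p23 ∧ h p134) (h p34)
  rel_p234 : ¬(h p2 ∧ h p134) → NotExactlyOne (h p124 ∧ h p3) (h p4) (h p234)

/-- The Plücker coordinates in `h` are invertible at the point `x` of the chart and all the others
vanish there. -/
def HasPattern {A : Type*} [CommRing A] (h : PluckerLabel → Prop) (x : ChartCoord → A) : Prop :=
  ∀ l, (h l → IsUnit (plucker x l)) ∧ (¬ h l → plucker x l = 0)

theorem hasPattern_iff_ne_zero {K : Type*} [Field K] {h : PluckerLabel → Prop}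
    {x : ChartCoord → K} : HasPattern h x ↔ ∀ l, plucker x l ≠ 0 ↔ h l := by
  refine forall_congr' fun l => ?_
  rw [isUnit_iff_ne_zero]
  tauto

/-- The coordinates `τ` avoid the hypersurfaces on which a pattern may fail to be realised with
coordinates from `τ`. -/
structure IsGeneric (τ : ChartCoord → ℂ) : Prop where
  ne_zero : ∀ i, τ i ≠ 0
  p23 : τ x2 * τ u3 - τ x3 ≠ 0
  p24 : τ x2 * τ u4 - τ x4 ≠ 0
  p34 : τ x3 * τ u4 - τ x4 * τ u3 ≠ 0
  p134 : τ w4 * τ u3 - τ u4 ≠ 0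
  p234 : τ w4 * τ x3 - τ x4 ≠ 0
  sum : τ x2 * τ u4 - τ x4 + τ x3 * τ w4 ≠ 0
  sum' : τ x2 * τ u4 + τ x3 * τ w4 ≠ 0

theorem exists_isGeneric_of_aeval_ne_zero : ∃ G : MvPolynomial ChartCoord ℂ, G ≠ 0 ∧
    ∀ τ, MvPolynomial.aeval τ G ≠ 0 → IsGeneric τ := by
  let X : ChartCoord → MvPolynomial ChartCoord ℂ := MvPolynomial.X
  refine ⟨X x2 * X x3 * X x4 * X u3 * X u4 * X w4 * (X x2 * X u3 - X x3) * (X x2 * X u4 - X x4) *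
    (X x3 * X u4 - X x4 * X u3) * (X w4 * X u3 - X u4) * (X w4 * X x3 - X x4) *
    (X x2 * X u4 - X x4 + X x3 * X w4) * (X x2 * X u4 + X x3 * X w4), fun h => ?_, fun τ h => ?_⟩
  · have h0 := congrArg (MvPolynomial.aeval fun i : ChartCoord => (match i with
      | x2 => 2 | x3 => 3 | x4 => 5 | u3 => 7 | u4 => 11 | w4 => 13 : ℂ)) h
    simp only [map_mul, map_sub, map_add, X, MvPolynomial.aeval_X, map_zero] at h0
    norm_num at h0
  · simp only [map_mul, map_sub, map_add, X, MvPolynomial.aeval_X, mul_ne_zero_iff] at h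
    exact ⟨fun i => by cases i <;> tauto, by tauto, by tauto, by tauto, by tauto, by tauto,
      by tauto, by tauto⟩

/-- The coordinates in `I` form a coordinate system on every stratum with pattern `h`: up to
inverses they generate the other coordinates, and they can be prescribed generically. -/
structure IsCoordSystem (h : PluckerLabel → Prop) (I : Set ChartCoord) : Prop where
  mem : ∀ {A : Type} [CommRing A] [Algebra ℂ A] {x : ChartCoord → A}, HasPattern h x →
    ∀ L : Subalgebra ℂ A, IsInvClosed L → (∀ i ∈ I, x i ∈ L) → ∀ i, x i ∈ L
  exists_of_isGeneric : ∀ τ, IsGeneric τ →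
    ∃ x : ChartCoord → ℂ, HasPattern h x ∧ ∀ i ∈ I, x i = τ i

theorem exists_aeval_ne_zero {ι k : Type*} [CommRing k] [IsDomain k] [Infinite k]
    {G : MvPolynomial ι k} (hG : G ≠ 0) : ∃ τ : ι → k, MvPolynomial.aeval τ G ≠ 0 := by
  by_contra! h
  exact hG (MvPolynomial.funext fun τ => by simpa [MvPolynomial.aeval_eq_eval] using h τ)

variable {I : Set ChartCoord}

theorem IsCoordSystem.label_mem {h : PluckerLabel → Prop} (hI : IsCoordSystem h I) {i : ChartCoord}
    (hi : i ∈ I) : h i.label := by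
  obtain ⟨G, hG0, hG⟩ := exists_isGeneric_of_aeval_ne_zero
  obtain ⟨τ, hτ⟩ := exists_aeval_ne_zero hG0
  obtain ⟨x, hx, hxτ⟩ := hI.exists_of_isGeneric τ (hG τ hτ)
  rw [← hasPattern_iff_ne_zero.mp hx, plucker_label, hxτ i hi]
  exact (hG τ hτ).ne_zero i

namespace FlagMatroid

variable {Q : FlagMatroid 4 ![1, 2, 3]} {σ : Equiv.Perm (Fin 4)}

theorem hasPattern_chartPlucker (hσ : Q.IsChart σ) :
    HasPattern (Q.Has σ) fun i : ChartCoord => Q.chartPlucker hσ i.label := by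
  intro l
  rw [← Q.chartPlucker_eq_plucker hσ]
  exact ⟨Q.isUnit_chartPlucker hσ, Q.chartPlucker_eq_zero hσ⟩

theorem ratGenerates_of_isCoordSystem (hσ : Q.IsChart σ) (hI : IsCoordSystem (Q.Has σ) I) :
    RatGenerates ℂ ((fun i : ChartCoord => Q.chartPlucker hσ i.label) '' I) := by
  intro L hL hS
  refine Q.ratGenerates_chartPlucker hσ L hL ?_
  rintro _ ⟨i, rfl⟩
  exact hI.mem (hasPattern_chartPlucker hσ) L hL (fun j hj => hS ⟨j, hj, rfl⟩) i

/-- A nonzero polynomial in the coordinates of `I` does not vanish at some generic point, which can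
be completed to a complex point of the stratum. -/
theorem algebraicIndependent_of_isCoordSystem (hσ : Q.IsChart σ)
    (hI : IsCoordSystem (Q.Has σ) I) :
    AlgebraicIndependent ℂ fun i : I => Q.chartPlucker hσ (i : ChartCoord).label := by
  rw [AlgebraicIndependent, injective_iff_map_eq_zero]
  intro f hf
  by_contra hf0
  have hf' : MvPolynomial.rename ((↑) : I → ChartCoord) f ≠ 0 :=
    (map_ne_zero_iff _ (MvPolynomial.rename_injective _ Subtype.val_injective)).mpr hf0
  obtain ⟨G, hG0, hG⟩ := exists_isGeneric_of_aeval_ne_zero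
  obtain ⟨τ, hτ⟩ := exists_aeval_ne_zero (mul_ne_zero hf' hG0)
  rw [map_mul] at hτ
  obtain ⟨x, hx, hxτ⟩ := hI.exists_of_isGeneric τ (hG τ (right_ne_zero_of_mul hτ))
  obtain ⟨χ, hχ⟩ := Q.exists_algHom_chartPlucker hσ x (hasPattern_iff_ne_zero.mp hx)
  have τ_eq : τ ∘ ((↑) : I → ChartCoord) =
      fun i : I => χ (Q.chartPlucker hσ (i : ChartCoord).label) := by
    ext i
    rw [Function.comp_apply, hχ, hxτ i i.2]
  apply left_ne_zero_of_mul hτ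
  rw [MvPolynomial.aeval_rename, τ_eq, ← MvPolynomial.comp_aeval_apply, hf, map_zero]

theorem isSmoothConnected_faceHom {P : FlagMatroid 4 ![1, 2, 3]} (hPQ : P.IsFace Q)
    (hσ : P.IsChart σ) {I' : Set ChartCoord} (hI : I ⊆ I') (hP : IsCoordSystem (P.Has σ) I)
    (hQ : IsCoordSystem (Q.Has σ) I') : IsSmoothConnected (faceHom hPQ).toRingHom :=
  isSmoothConnected_of_coords (faceHom hPQ) hI
    (fun _ hi => faceHom_chartPlucker hPQ hσ (hP.label_mem hi))
    (ratGenerates_of_isCoordSystem hσ hP) (ratGenerates_of_isCoordSystem (hσ.mono hPQ) hQ)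
    (algebraicIndependent_of_isCoordSystem (hσ.mono hPQ) hQ)

end FlagMatroid

end CoordinateSystems

section PatternCases

open PluckerLabel ChartCoord

variable {h : PluckerLabel → Prop}

/-- The coordinate system in the case that `p124 = 0` or `p3 = p13 = p23 = p34 = 0`. -/
def coordsLeft (h : PluckerLabel → Prop) : Set ChartCoord := {i | match i with
  | x2 => h p2
  | x3 => h p3 ∧ ¬(h p13 ∧ ¬h p23) ∧ ¬(h p13 ∧ ¬h p34 ∧ h p14)
  | x4 => h p4
  | u3 => h p13
  | u4 => h p14 ∧ ¬(h p2 ∧ ¬h p24)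
  | w4 => h p124}

/-- The coordinate system in the case that `p2 = 0` or `p13 = p14 = p34 = p134 = 0`. -/
def coordsRight (h : PluckerLabel → Prop) : Set ChartCoord := {i | match i with
  | x2 => h p2
  | x3 => h p3 ∧ ¬(h p124 ∧ ¬h p234)
  | x4 => h p4
  | u3 => h p13
  | u4 => h p14 ∧ ¬(h p13 ∧ ¬h p134) ∧ ¬(h p13 ∧ ¬h p34 ∧ h p3)
  | w4 => h p124}

/-- The coordinate system in the case that `p13 = 0` while `p3`, `p14`, `p23`, `p34` and `p134` do
not vanish. -/
def coordsMiddle (h : PluckerLabel → Prop) : Set ChartCoord := {i | match i with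
  | x2 => h p2
  | x3 => h p3
  | x4 => h p4 ∧ ¬(h p2 ∧ h p14 ∧ ¬h p24)
  | u3 => h p13
  | u4 => h p14
  | w4 => h p124 ∧ h p234}

theorem IsInvClosed.mem_of_mul_mem {R A : Type*} [CommRing R] [CommRing A] [Algebra R A]
    {L : Subalgebra R A} (hL : IsInvClosed L) {a b : A} (ha : a ∈ L) (hu : IsUnit a)
    (hab : a * b ∈ L) : b ∈ L := by
  obtain ⟨c, hc⟩ := hu.exists_right_inv
  have h := L.mul_mem (hL a c ha hc) hab
  rwa [← mul_assoc, mul_comm c, hc, one_mul] at h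

section Generation

variable {A : Type*} [CommRing A] [Algebra ℂ A] {x : ChartCoord → A} {L : Subalgebra ℂ A}

theorem HasPattern.mem_of_imp (hx : HasPattern h x) (i : ChartCoord) (hi : h i.label → x i ∈ L) :
    x i ∈ L := by
  by_cases hl : h i.label
  · exact hi hl
  · rw [← plucker_label x i, (hx _).2 hl]
    exact L.zero_mem

theorem HasPattern.mem_of_coordsLeft (hx : HasPattern h x) (hL : IsInvClosed L)
    (hI : ∀ i ∈ coordsLeft h, x i ∈ L) (i : ChartCoord) : x i ∈ L := by
  have mem_x2 : x x2 ∈ L := hx.mem_of_imp x2 (hI x2)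
  have mem_x4 : x x4 ∈ L := hx.mem_of_imp x4 (hI x4)
  have mem_u3 : x u3 ∈ L := hx.mem_of_imp u3 (hI u3)
  have mem_w4 : x w4 ∈ L := hx.mem_of_imp w4 (hI w4)
  have mem_u4 : x u4 ∈ L := hx.mem_of_imp u4 fun h14 => by
    by_cases hc : h p2 ∧ ¬h p24
    · have e : x x2 * x u4 = x x4 := sub_eq_zero.mp ((hx p24).2 hc.2)
      exact hL.mem_of_mul_mem mem_x2 ((hx p2).1 hc.1) (e ▸ mem_x4)
    · exact hI u4 ⟨h14, hc⟩
  have mem_x3 : x x3 ∈ L := hx.mem_of_imp x3 fun h3 => by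
    by_cases hc : h p13 ∧ ¬h p23
    · have e : x x2 * x u3 = x x3 := sub_eq_zero.mp ((hx p23).2 hc.2)
      exact e ▸ L.mul_mem mem_x2 mem_u3
    by_cases hc' : h p13 ∧ ¬h p34 ∧ h p14
    · have e : x x3 * x u4 = x x4 * x u3 := sub_eq_zero.mp ((hx p34).2 hc'.2.1)
      exact hL.mem_of_mul_mem mem_u4 ((hx p14).1 hc'.2.2)
        (mul_comm (x x3) _ ▸ e ▸ L.mul_mem mem_x4 mem_u3)
    · exact hI x3 ⟨h3, hc, hc'⟩
  cases i <;> assumption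

theorem HasPattern.mem_of_coordsRight (hx : HasPattern h x) (h2 : ¬ h p2 ∨ ¬ h p134)
    (hL : IsInvClosed L) (hI : ∀ i ∈ coordsRight h, x i ∈ L) (i : ChartCoord) : x i ∈ L := by
  have mem_x2 : x x2 ∈ L := hx.mem_of_imp x2 (hI x2)
  have mem_x4 : x x4 ∈ L := hx.mem_of_imp x4 (hI x4)
  have mem_u3 : x u3 ∈ L := hx.mem_of_imp u3 (hI u3)
  have mem_w4 : x w4 ∈ L := hx.mem_of_imp w4 (hI w4)
  have mul_eq_zero : x x2 * (x u3 * x w4 - x u4) = 0 := by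
    rcases h2 with h2 | h134
    · rw [show x x2 = 0 from (hx p2).2 h2, zero_mul]
    · rw [show x u3 * x w4 - x u4 = 0 from (hx p134).2 h134, mul_zero]
  have mem_x3 : x x3 ∈ L := hx.mem_of_imp x3 fun h3 => by
    by_cases hc : h p124 ∧ ¬h p234
    · have e : x x2 * (x u3 * x w4 - x u4) - x x3 * x w4 + x x4 = 0 := (hx p234).2 hc.2
      have e' : x w4 * x x3 = x x4 := by linear_combination mul_eq_zero - e
      exact hL.mem_of_mul_mem mem_w4 ((hx p124).1 hc.1) (e' ▸ mem_x4)
    · exact hI x3 ⟨h3, hc⟩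
  have mem_u4 : x u4 ∈ L := hx.mem_of_imp u4 fun h14 => by
    by_cases hc : h p13 ∧ ¬h p134
    · have e : x u3 * x w4 = x u4 := sub_eq_zero.mp ((hx p134).2 hc.2)
      exact e ▸ L.mul_mem mem_u3 mem_w4
    by_cases hc' : h p13 ∧ ¬h p34 ∧ h p3
    · have e : x x3 * x u4 = x x4 * x u3 := sub_eq_zero.mp ((hx p34).2 hc'.2.1)
      exact hL.mem_of_mul_mem mem_x3 ((hx p3).1 hc'.2.2) (e ▸ L.mul_mem mem_x4 mem_u3)
    · exact hI u4 ⟨h14, hc, hc'⟩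
  cases i <;> assumption

theorem HasPattern.mem_of_coordsMiddle (hx : HasPattern h x) (h3 : h p3) (h13 : ¬ h p13)
    (hL : IsInvClosed L) (hI : ∀ i ∈ coordsMiddle h, x i ∈ L) (i : ChartCoord) : x i ∈ L := by
  have mem_x2 : x x2 ∈ L := hx.mem_of_imp x2 (hI x2)
  have mem_x3 : x x3 ∈ L := hx.mem_of_imp x3 (hI x3)
  have mem_u3 : x u3 ∈ L := hx.mem_of_imp u3 (hI u3)
  have mem_u4 : x u4 ∈ L := hx.mem_of_imp u4 (hI u4)
  have mem_x4 : x x4 ∈ L := hx.mem_of_imp x4 fun h4 => by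
    by_cases hc : h p2 ∧ h p14 ∧ ¬h p24
    · have e : x x2 * x u4 = x x4 := sub_eq_zero.mp ((hx p24).2 hc.2.2)
      exact e ▸ L.mul_mem mem_x2 mem_u4
    · exact hI x4 ⟨h4, hc⟩
  have mem_w4 : x w4 ∈ L := hx.mem_of_imp w4 fun h124 => by
    by_cases hc : h p234
    · exact hI w4 ⟨h124, hc⟩
    · have e : x x2 * (x u3 * x w4 - x u4) - x x3 * x w4 + x x4 = 0 := (hx p234).2 hc
      have hu3 : x u3 = 0 := (hx p13).2 h13
      have e' : x x3 * x w4 = x x4 - x x2 * x u4 := by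
        linear_combination x x2 * x w4 * hu3 - e
      exact hL.mem_of_mul_mem mem_x3 ((hx p3).1 h3)
        (e' ▸ L.sub_mem mem_x4 (L.mul_mem mem_x2 mem_u4))
  cases i <;> assumption

end Generation

namespace IsFlagPattern

theorem isCoordSystem_of_not_p124 (hh : IsFlagPattern h) (h124 : ¬ h p124) :
    IsCoordSystem h (coordsLeft h) where
  mem hx _ := hx.mem_of_coordsLeft
  exists_of_isGeneric τ hτ := by
    have h14_iff : h p14 ↔ h p134 := hh.rel_p134.iff_of_not fun H => h124 H.1
    have h24_iff : h p24 ↔ h p234 := hh.rel_line2.iff_of_not fun H => h124 H.2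
    obtain ⟨x, y, z, u, v, hx, hy, hz, hd, hu, hv, he, hf, ex, ey, ez, eu, ev⟩ :=
      exists_two_rows hh.rel_p24 hh.rel_p23 hh.rel_p34 hh.rel_p34' (hτ.ne_zero x2) (hτ.ne_zero u4)
        (hτ.ne_zero x4) (hτ.ne_zero u3) (hτ.ne_zero x3) hτ.p24 hτ.p23 hτ.p34
    refine ⟨fun | .x2 => x | .x3 => v | .x4 => z | .u3 => u | .u4 => y | .w4 => 0,
      hasPattern_iff_ne_zero.mpr fun l => ?_, fun i hi => ?_⟩
    · cases l
      case p1 | p12 | p123 => simp [ChartCoord.plucker, hh.has_p1, hh.has_p12, hh.has_p123]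
      case p124 => simp [ChartCoord.plucker, h124]
      case p134 => simp [ChartCoord.plucker, ← h14_iff, ← hy]
      case p234 =>
        rw [← h24_iff, ← hd, ← neg_ne_zero]
        simp only [ChartCoord.plucker, mul_zero, zero_sub, sub_zero, mul_neg, neg_add_rev, neg_neg]
        rw [neg_add_eq_sub]
      all_goals assumption
    · cases i
      case w4 => exact absurd hi h124
      all_goals revert hi; assumption

theorem isCoordSystem_of_not_p2 (hh : IsFlagPattern h) (h2 : ¬ h p2) :
    IsCoordSystem h (coordsRight h) where
  mem hx _ := hx.mem_of_coordsRight (Or.inl h2)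
  exists_of_isGeneric τ hτ := by
    have h3_iff : h p3 ↔ h p23 := hh.rel_p23.iff_of_not fun H => h2 H.1
    have h4_iff : h p4 ↔ h p24 := hh.rel_p24.iff_of_not fun H => h2 H.1
    have rel_p34 : NotExactlyOne (h p14 ∧ h p3) (h p4 ∧ h p13) (h p34) := by
      rw [and_comm]; exact hh.rel_p34
    have rel_line3 : NotExactlyOne (h p13 ∧ h p234) (h p3 ∧ h p134) (h p34) := by
      rw [h3_iff]; exact hh.rel_line3
    obtain ⟨x, y, z, u, v, hx, hy, hz, hd, hu, hv, he, hf, ex, ey, ez, eu, ev⟩ :=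
      exists_two_rows (hh.rel_p234 fun H => h2 H.1) hh.rel_p134 rel_p34 rel_line3 (hτ.ne_zero w4)
        (hτ.ne_zero x3) (hτ.ne_zero x4) (hτ.ne_zero u3) (hτ.ne_zero u4) hτ.p234 hτ.p134
        (by rw [mul_comm]; exact hτ.p34)
    refine ⟨fun | .x2 => 0 | .x3 => y | .x4 => z | .u3 => u | .u4 => v | .w4 => x,
      hasPattern_iff_ne_zero.mpr fun l => ?_, fun i hi => ?_⟩
    · cases l
      case p1 | p12 | p123 => simp [ChartCoord.plucker, hh.has_p1, hh.has_p12, hh.has_p123]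
      case p2 => simp [ChartCoord.plucker, h2]
      case p23 => simp [ChartCoord.plucker, ← h3_iff, ← hy]
      case p24 => simp [ChartCoord.plucker, ← h4_iff, ← hz]
      case p34 => rw [← hf]; simp [ChartCoord.plucker, mul_comm]
      case p134 => rw [← he]; simp [ChartCoord.plucker, mul_comm]
      case p234 =>
        rw [← hd, ← neg_ne_zero]
        simp only [ChartCoord.plucker]
        rw [show x * y - z = -(0 * (u * x - v) - y * x + z) by ring]
      all_goals assumption
    · cases i
      case x2 => exact absurd hi h2
      all_goals revert hi; assumption

theorem isCoordSystem_of_not_p3 (hh : IsFlagPattern h) (h3 : ¬ h p3) (h13 : ¬ h p13)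
    (h23 : ¬ h p23) (h34 : ¬ h p34) : IsCoordSystem h (coordsLeft h) where
  mem hx _ := hx.mem_of_coordsLeft
  exists_of_isGeneric τ hτ := by
    classical
    have h14_iff : h p14 ↔ h p134 := hh.rel_p134.iff_of_not fun H => h13 H.2
    have h24_iff : h p24 ↔ h p234 := hh.rel_line2.iff_of_not fun H => h23 H.1
    obtain ⟨x, y, z, hx, hy, hz, hd, ex, ey, ez, -, -, -⟩ := exists_three_term hh.rel_p24
      (hτ.ne_zero x2) (hτ.ne_zero u4) (hτ.ne_zero x4) hτ.p24
    refine ⟨fun | .x2 => x | .x3 => 0 | .x4 => z | .u3 => 0 | .u4 => y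
                | .w4 => if h p124 then τ w4 else 0,
      hasPattern_iff_ne_zero.mpr fun l => ?_, fun i hi => ?_⟩
    · cases l
      case p1 | p12 | p123 => simp [ChartCoord.plucker, hh.has_p1, hh.has_p12, hh.has_p123]
      case p3 | p13 | p23 | p34 => simp [ChartCoord.plucker, h3, h13, h23, h34]
      case p124 => simp [ChartCoord.plucker, hτ.ne_zero]
      case p134 => simp [ChartCoord.plucker, ← h14_iff, ← hy]
      case p234 =>
        rw [← h24_iff, ← hd, ← neg_ne_zero]
        simp only [ChartCoord.plucker, zero_mul, zero_sub, sub_zero, mul_neg, neg_add_rev, neg_neg]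
        rw [neg_add_eq_sub]
      all_goals assumption
    · cases i
      case x3 => exact absurd hi.1 h3
      case u3 => exact absurd hi h13
      case w4 => exact if_pos hi
      all_goals revert hi; assumption

theorem isCoordSystem_of_not_p134 (hh : IsFlagPattern h) (h13 : ¬ h p13) (h14 : ¬ h p14)
    (h34 : ¬ h p34) (h134 : ¬ h p134) : IsCoordSystem h (coordsRight h) where
  mem hx _ := hx.mem_of_coordsRight (Or.inr h134)
  exists_of_isGeneric τ hτ := by
    classical
    have h3_iff : h p3 ↔ h p23 := hh.rel_p23.iff_of_not fun H => h13 H.2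
    have h4_iff : h p4 ↔ h p24 := hh.rel_p24.iff_of_not fun H => h14 H.2
    obtain ⟨x, y, z, hx, hy, hz, hd, ex, ey, ez, -, -, -⟩ :=
      exists_three_term (hh.rel_p234 fun H => h134 H.2) (hτ.ne_zero w4) (hτ.ne_zero x3)
        (hτ.ne_zero x4) hτ.p234
    refine ⟨fun | .x2 => if h p2 then τ x2 else 0 | .x3 => y | .x4 => z | .u3 => 0 | .u4 => 0
                | .w4 => x, hasPattern_iff_ne_zero.mpr fun l => ?_, fun i hi => ?_⟩
    · cases l
      case p1 | p12 | p123 => simp [ChartCoord.plucker, hh.has_p1, hh.has_p12, hh.has_p123]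
      case p2 => simp [ChartCoord.plucker, hτ.ne_zero]
      case p13 | p14 | p34 | p134 => simp [ChartCoord.plucker, h13, h14, h34, h134]
      case p23 => simp [ChartCoord.plucker, ← h3_iff, ← hy]
      case p24 => simp [ChartCoord.plucker, ← h4_iff, ← hz]
      case p234 =>
        rw [← hd, ← neg_ne_zero]
        simp only [ChartCoord.plucker, zero_mul, sub_zero, mul_zero, zero_sub]
        rw [show x * y - z = -(-(y * x) + z) by ring]
      all_goals assumption
    · cases i
      case x2 => exact if_pos hi
      case u3 => exact absurd hi h13
      case u4 => exact absurd hi.1 h14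
      all_goals revert hi; assumption

end IsFlagPattern

theorem exists_add_mul_ne_zero_iff {a b c : Prop} (hr : NotExactlyOne a c b) {d s t : ℂ}
    (hd : d ≠ 0 ↔ c) (hs : s ≠ 0) (ht : t ≠ 0) (hdst : d + s * t ≠ 0) :
    ∃ w : ℂ, (w ≠ 0 ↔ a) ∧ (d + s * w ≠ 0 ↔ b) ∧ (a ∧ b → w = t) := by
  by_cases ha : a
  · by_cases hb : b
    · exact ⟨t, by simp [ha, ht], by simp [hb, hdst], fun _ => rfl⟩
    · have hd0 : d ≠ 0 := hd.mpr ((hr.1 ha).resolve_right hb)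
      refine ⟨-d / s, by simp [ha, hd0, hs], ?_, by simp [hb]⟩
      rw [mul_div_cancel₀ _ hs, add_neg_cancel]
      simp [hb]
  · refine ⟨0, by simp [ha], ?_, by simp [ha]⟩
    rw [mul_zero, add_zero, hd]
    exact hr.iff_of_not ha

theorem IsFlagPattern.isCoordSystem_of_not_p13 (hh : IsFlagPattern h) (h13 : ¬ h p13) (h3 : h p3)
    (h14 : h p14) (h23 : h p23) (h34 : h p34) (h134 : h p134) :
    IsCoordSystem h (coordsMiddle h) where
  mem hx _ := hx.mem_of_coordsMiddle h3 h13
  exists_of_isGeneric τ hτ := by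
    have hτ3 := hτ.ne_zero x3
    obtain ⟨x, y, z, hx, hy, hz, hd, ey, ex, ez, x_eq, z_eq⟩ := exists_three_term' hh.rel_p24
      (hτ.ne_zero x2) (hτ.ne_zero u4) (hτ.ne_zero x4) hτ.p24
    have hy0 : y ≠ 0 := hy.mpr h14
    have sum_ne_zero : x * y - z + τ x3 * τ w4 ≠ 0 := by
      rw [ey h14] at z_eq ⊢
      rcases z_eq with rfl | rfl | z_eq
      · rcases x_eq with rfl | rfl
        · simp [hτ3, hτ.ne_zero]
        · simpa using hτ.sum'
      · rcases x_eq with rfl | rfl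
        · rw [zero_mul, zero_sub, neg_add_eq_sub, mul_comm]; exact hτ.p234
        · exact hτ.sum
      · simp [z_eq, hτ3, hτ.ne_zero]
    have rel : NotExactlyOne (h p124) (h p24) (h p234) := by
      simpa only [h23, true_and] using hh.rel_line2
    obtain ⟨w, hw124, hw234, ew⟩ :=
      exists_add_mul_ne_zero_iff rel hd hτ3 (hτ.ne_zero w4) sum_ne_zero
    refine ⟨fun | .x2 => x | .x3 => τ x3 | .x4 => z | .u3 => 0 | .u4 => y | .w4 => w,
      hasPattern_iff_ne_zero.mpr fun l => ?_, fun i hi => ?_⟩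
    · cases l
      case p1 | p12 | p123 => simp [ChartCoord.plucker, hh.has_p1, hh.has_p12, hh.has_p123]
      case p3 | p13 | p23 | p34 | p134 =>
        simp [ChartCoord.plucker, h3, h13, h23, h34, h134, hτ3, hy0]
      case p234 =>
        rw [← hw234, ← neg_ne_zero]
        simp only [ChartCoord.plucker]
        rw [show x * y - z + τ x3 * w = -(x * (0 * w - y) - τ x3 * w + z) by ring]
      all_goals assumption
    · cases i
      case x3 => rfl
      case u3 => exact absurd hi h13
      all_goals revert hi; assumption

end PatternCases

section Polytope

theorem eq_of_mem_intrinsicInterior {E : Type*} [NormedAddCommGroup E] [NormedSpace ℝ E] {s : Set E}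
    {x z : E} (hx : x ∈ intrinsicInterior ℝ s) (hz : z ∈ s) (f : E →ₗ[ℝ] ℝ)
    (hf : ∀ y ∈ s, f y ≤ f x) : f z = f x := by
  obtain ⟨y, hy, rfl⟩ := mem_intrinsicInterior.mp hx
  refine le_antisymm (hf z hz) (not_lt.mp fun hlt => ?_)
  let z' : affineSpan ℝ s := ⟨z, subset_affineSpan ℝ s hz⟩
  have : Nonempty (affineSpan ℝ s) := ⟨y⟩
  -- Beyond `y`, the line from `z` to `y` stays in `s` for a while, but `f` exceeds `f y` there.
  have eventually_mem : ∀ᶠ t : ℝ in nhds 0,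
      AffineMap.lineMap y z' t ∈ interior ((↑) ⁻¹' s : Set (affineSpan ℝ s)) :=
    AffineMap.lineMap_continuous.continuousAt.eventually_mem
      (isOpen_interior.mem_nhds (by simpa using hy))
  obtain ⟨ε, hε, hball⟩ := Metric.eventually_nhds_iff.mp eventually_mem
  have dist_lt : dist (-(ε / 2)) 0 < ε := by
    rw [Real.dist_eq, sub_zero, abs_neg, abs_of_pos (half_pos hε)]
    exact half_lt_self hε
  have coe_lineMap : ((AffineMap.lineMap y z' (-(ε / 2)) : affineSpan ℝ s) : E) =
      (y : E) + (-(ε / 2)) • (z - y) := by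
    rw [AffineMap.lineMap_apply]
    simp [z', add_comm]
  have mem : AffineMap.lineMap y z' (-(ε / 2)) ∈ ((↑) ⁻¹' s : Set (affineSpan ℝ s)) :=
    interior_subset (hball dist_lt)
  have hle := hf _ mem
  rw [coe_lineMap, map_add, map_smul, map_sub, smul_eq_mul] at hle
  nlinarith

theorem exists_exchange_of_isFlat {α : Type*} {M N : Matroid α} (hE : M.E = N.E)
    (hMN : ∀ F, M.IsFlat F → N.IsFlat F) {b c : Set α} (hb : M.IsBase b) (hc : N.IsBase c) {e : α}
    (heb : e ∈ b) (hec : e ∉ c) :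
    ∃ f ∈ c, f ∉ b ∧ M.IsBase (insert f (b \ {e})) ∧ N.IsBase (insert e (c \ {f})) := by
  have heM : e ∈ M.E := hb.subset_ground heb
  have heN : e ∈ N.E := hE ▸ heM
  -- Take `f` in the circuit of `N` inside `c + e`, but outside the flat of `M` spanned by `b - e`.
  let H := M.closure (b \ {e})
  have heH : e ∉ H := hb.indep.notMem_closure_sdiff_of_mem heb
  obtain ⟨f, hfC, hfH⟩ : ∃ f ∈ N.fundCircuit e c \ {e}, f ∉ H := by
    by_contra! hsub
    have hcl := N.closure_subset_closure (show _ ⊆ H from hsub)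
      ((hc.fundCircuit_isCircuit heN hec).mem_closure_sdiff_singleton_of_mem
        (N.mem_fundCircuit e c))
    rw [(hMN H (Matroid.isFlat_closure _)).closure] at hcl
    exact heH hcl
  have hfc : f ∈ c :=
    (Set.mem_insert_iff.mp (N.fundCircuit_subset_insert e c hfC.1)).resolve_left hfC.2
  have hfM : f ∈ M.E := hE ▸ hc.subset_ground hfc
  refine ⟨f, hfc, fun hfb => hfH (M.mem_closure_of_mem (X := b \ {e}) ⟨hfb, hfC.2⟩
    (Set.sdiff_subset.trans hb.subset_ground)), hb.exchange_base_of_notMem_closure heb hfH hfM, ?_⟩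
  have hindep : N.Indep (insert e c \ {f}) :=
    (hc.indep.mem_fundCircuit_iff (by rwa [hc.closure_eq]) hec).mp hfC.1
  rw [← Set.insert_sdiff_singleton_comm (Ne.symm hfC.2)] at hindep
  exact hc.exchange_isBase_of_indep hec hindep

theorem exists_ne_card_eq {α : Type*} [Fintype α] {S : Finset α} (hS : S.Nonempty)
    (hS' : S ≠ Finset.univ) : ∃ T, T.card = S.card ∧ T ≠ S := by
  classical
  obtain ⟨e, he⟩ := hS
  obtain ⟨g, hg⟩ : ∃ g, g ∉ S := not_forall.mp fun H => hS' (Finset.eq_univ_of_forall H)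
  refine ⟨insert g (S.erase e), ?_, fun H => hg (H ▸ Finset.mem_insert_self _ _)⟩
  rw [Finset.card_insert_of_notMem fun h => hg (Finset.mem_of_mem_erase h),
    Finset.card_erase_add_one he]

variable {n s : ℕ} {r : Fin s → ℕ}

/-- The linear form that adds up the coordinates in `S`. -/
def coordSum (S : Finset (Fin n)) : (Fin n → ℝ) →ₗ[ℝ] ℝ := ∑ k ∈ S, LinearMap.proj k

theorem coordSum_sum_indicator (S : Finset (Fin n)) (l : Fin s → Finset (Fin n)) :
    coordSum S (∑ i, fun k => if k ∈ l i then (1 : ℝ) else 0) = ∑ i, ((l i ∩ S).card : ℝ) := by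
  simp only [coordSum, LinearMap.coe_sum, LinearMap.coe_proj, Finset.sum_apply, Function.eval]
  rw [Finset.sum_comm]
  refine Finset.sum_congr rfl fun i _ => ?_
  rw [Finset.sum_boole, Finset.filter_mem_eq_inter, Finset.inter_comm]

theorem card_inter_le_min (S T : Finset (Fin n)) : (T ∩ S).card ≤ min T.card S.card :=
  le_min (Finset.card_le_card Finset.inter_subset_left)
    (Finset.card_le_card Finset.inter_subset_right)

theorem coordSum_le_of_mem_uniformFlagPolytope (S : Finset (Fin n)) {y : Fin n → ℝ}
    (hy : y ∈ uniformFlagPolytope n r) : coordSum S y ≤ ∑ j, (min (r j) S.card : ℕ) := by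
  suffices uniformFlagPolytope n r ⊆ coordSum S ⁻¹' Set.Iic ((∑ j, min (r j) S.card : ℕ) : ℝ) by
    simpa using this hy
  refine convexHull_min ?_ ((convex_Iic _).linear_preimage _)
  rintro _ ⟨l, hl, rfl⟩
  rw [Set.mem_preimage, coordSum_sum_indicator, Set.mem_Iic]
  exact_mod_cast Finset.sum_le_sum fun j _ => hl j ▸ card_inter_le_min S (l j)

namespace FlagMatroid

theorem exists_exchange (Q : FlagMatroid n r) {i j : Fin s} (hij : i ≤ j) {b c : Finset (Fin n)}
    (hb : b ∈ Q.bases i) (hc : c ∈ Q.bases j) {e : Fin n} (heb : e ∈ b) (hec : e ∉ c) :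
    ∃ f ∈ c, f ∉ b ∧ insert f (b.erase e) ∈ Q.bases i ∧ insert e (c.erase f) ∈ Q.bases j := by
  obtain ⟨f, hfc, hfb, hbf, hcf⟩ := exists_exchange_of_isFlat
    ((Q.ground_eq i).trans (Q.ground_eq j).symm) (Q.isFlat_of_le i j hij) hb hc heb hec
  exact ⟨f, hfc, hfb, by simpa [bases] using hbf, by simpa [bases] using hcf⟩

theorem card_inter_of_bases_eq_singleton (P : FlagMatroid n r) {i : Fin s} {S : Finset (Fin n)}
    (hS : P.bases i = {S}) {j : Fin s} {b : Finset (Fin n)} (hb : b ∈ P.bases j) :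
    (b ∩ S).card = min (r j) S.card := by
  have hSi : S ∈ P.bases i := hS ▸ rfl
  have subset_or_subset : b ⊆ S ∨ S ⊆ b := by
    rcases le_total j i with hji | hij
    · refine Or.inl fun e he => by_contra fun heS => ?_
      obtain ⟨f, -, -, -, h⟩ := P.exists_exchange hji hb hSi he heS
      rw [hS, Set.mem_singleton_iff] at h
      exact heS (h ▸ Finset.mem_insert_self _ _)
    · refine Or.inr fun e he => by_contra fun heb => ?_
      obtain ⟨f, -, hf, h, -⟩ := P.exists_exchange hij hSi hb he heb
      rw [hS, Set.mem_singleton_iff] at h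
      exact hf (h ▸ Finset.mem_insert_self _ _)
  rw [← P.card_of_mem_bases hb]
  rcases subset_or_subset with h | h
  · rw [Finset.inter_eq_left.mpr h, min_eq_left (Finset.card_le_card h)]
  · rw [Finset.inter_eq_right.mpr h, min_eq_right (Finset.card_le_card h)]

theorem coordSum_of_mem_polytope (P : FlagMatroid n r) {i : Fin s} {S : Finset (Fin n)}
    (hS : P.bases i = {S}) {x : Fin n → ℝ} (hx : x ∈ P.polytope) :
    coordSum S x = ∑ j, (min (r j) S.card : ℕ) := by
  suffices P.polytope ⊆ coordSum S ⁻¹' {((∑ j, min (r j) S.card : ℕ) : ℝ)} by simpa using this hx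
  refine convexHull_min ?_ ((convex_singleton _).linear_preimage _)
  rintro _ ⟨l, hl, rfl⟩
  rw [Set.mem_preimage, coordSum_sum_indicator, Set.mem_singleton_iff]
  exact_mod_cast Finset.sum_congr rfl fun j _ => P.card_inter_of_bases_eq_singleton hS (hl j)

theorem IsInternal.exists_ne {P : FlagMatroid n r} (hP : P.IsInternal) {i : Fin s} (hi : 1 ≤ r i)
    (hi' : r i < n) (S : Finset (Fin n)) : ∃ b ∈ P.bases i, b ≠ S := by
  by_contra! hall
  choose b hb using P.bases_nonempty
  have hSi : S ∈ P.bases i := hall (b i) (hb i) ▸ hb i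
  have hS : P.bases i = {S} := Set.eq_singleton_iff_unique_mem.mpr ⟨hSi, hall⟩
  have card_S := P.card_of_mem_bases hSi
  obtain ⟨T, card_T, hTS⟩ := exists_ne_card_eq (S := S) (Finset.card_pos.mp (by omega))
    fun H => by simp [H] at card_S; omega
  let l : Fin s → Finset (Fin n) := Function.update b i T
  have card_l (j) : (l j).card = r j := by
    by_cases h : j = i
    · subst h
      simp [l, card_T, card_S]
    · simp [l, h, P.card_of_mem_bases (hb j)]
  have card_inter_lt : (l i ∩ S).card < min (r i) S.card := by
    rw [← card_S, min_self]
    refine Finset.card_lt_card (Finset.inter_subset_right.ssubset_of_ne fun h => hTS ?_)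
    exact (Finset.eq_of_subset_of_card_le (by simpa [l] using h) card_T.le).symm
  have sum_lt : ∑ j, (l j ∩ S).card < ∑ j, min (r j) S.card :=
    Finset.sum_lt_sum (fun j _ => card_l j ▸ card_inter_le_min S (l j))
      ⟨i, Finset.mem_univ _, card_inter_lt⟩
  obtain ⟨x, hxP, hx⟩ := hP
  have hfx := P.coordSum_of_mem_polytope hS hxP
  have hz := eq_of_mem_intrinsicInterior hx (subset_convexHull ℝ _ ⟨l, card_l, rfl⟩) (coordSum S)
    fun y hy => (coordSum_le_of_mem_uniformFlagPolytope S hy).trans_eq hfx.symm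
  rw [hfx, coordSum_sum_indicator] at hz
  exact sum_lt.ne (by exact_mod_cast hz)

theorem ext_bases {P Q : FlagMatroid n r} (h : ∀ i, P.bases i = Q.bases i) : P = Q := by
  have matroid_eq : P.matroid = Q.matroid := by
    funext i
    refine Matroid.ext_isBase (by rw [P.ground_eq, Q.ground_eq]) fun B _ => ?_
    simpa [bases] using Set.ext_iff.mp (h i) (Set.toFinite B).toFinset
  cases P
  cases Q
  cases matroid_eq
  rfl

end FlagMatroid

end Polytope

section FacePatterns

open PluckerLabel

/-- The set of columns of a label, counted from `0`. -/
def PluckerLabel.columnSet : PluckerLabel → Finset (Fin 4)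
  | p1 => {0}
  | p2 => {1}
  | p3 => {2}
  | p4 => {3}
  | p12 => {0, 1}
  | p13 => {0, 2}
  | p14 => {0, 3}
  | p23 => {1, 2}
  | p24 => {1, 3}
  | p34 => {2, 3}
  | p123 => {0, 1, 2}
  | p124 => {0, 1, 3}
  | p134 => {0, 2, 3}
  | p234 => {1, 2, 3}

theorem PluckerLabel.map_columnsVia (σ : Equiv.Perm (Fin 4)) (l : PluckerLabel) :
    Finset.univ.map (l.columnsVia σ) = l.columnSet.map σ.toEmbedding := by
  have map_columns : Finset.univ.map l.columns = l.columnSet := by cases l <;> decide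
  rw [columnsVia, ← Finset.map_map, map_columns]

/-- The excess of the weight of a label over that of the standard flag, for the weight vector
`(0, b, c, d)`. -/
def PluckerLabel.excess (b c d : ℝ) : PluckerLabel → ℝ
  | p1 => 0
  | p2 => b
  | p3 => c
  | p4 => d
  | p12 => 0
  | p13 => c - b
  | p14 => d - b
  | p23 => c
  | p24 => d
  | p34 => c + d - b
  | p123 => 0
  | p124 => d - c
  | p134 => d - b
  | p234 => d

theorem PluckerLabel.sum_columnSet (w : Fin 4 → ℝ) (l : PluckerLabel) : ∑ k ∈ l.columnSet, w k =
    excess (w 1 - w 0) (w 2 - w 0) (w 3 - w 0) l + ![w 0, w 0 + w 1, w 0 + w 1 + w 2] l.level := by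
  cases l <;> simp [columnSet, level, excess]
  all_goals ring

/-- The labels in `p` are those of minimal weight among the labels in `q`, for a weight vector
`(0, b, c, d)` that is minimal on the standard flag. -/
structure IsInitialPattern (p q : PluckerLabel → Prop) (b c d : ℝ) : Prop where
  excess_nonneg : ∀ l, q l → 0 ≤ excess b c d l
  iff_excess_eq_zero : ∀ l, p l ↔ q l ∧ excess b c d l = 0

theorem coordsLeft_subset {p q : PluckerLabel → Prop} (hpq : ∀ l, p l → q l) (h3 : ¬ p p3)
    (h2 : p p14 → q p2 → p p2) : coordsLeft p ⊆ coordsLeft q := by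
  intro i hi
  cases i
  case x3 => exact absurd hi.1 h3
  case u4 => exact ⟨hpq _ hi.1, fun H => hi.2 ⟨h2 hi.1 H.1, mt (hpq _) H.2⟩⟩
  all_goals exact hpq _ hi

theorem coordsRight_subset {p q : PluckerLabel → Prop} (hpq : ∀ l, p l → q l)
    (h124 : p p3 → q p124 → p p124) (h14 : p p14 → q p34 ∧ q p134) :
    coordsRight p ⊆ coordsRight q := by
  intro i hi
  cases i
  case x3 => exact ⟨hpq _ hi.1, fun H => hi.2 ⟨h124 hi.1 H.1, mt (hpq _) H.2⟩⟩
  case u4 => exact ⟨hpq _ hi.1, fun H => H.2 (h14 hi.1).2, fun H => H.2.1 (h14 hi.1).1⟩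
  all_goals exact hpq _ hi

theorem coordsMiddle_subset {p q : PluckerLabel → Prop} (hpq : ∀ l, p l → q l) (h4 : ¬ p p4) :
    coordsMiddle p ⊆ coordsMiddle q := by
  intro i hi
  cases i
  case x4 => exact absurd hi.1 h4
  case w4 => exact ⟨hpq _ hi.1, hpq _ hi.2⟩
  all_goals exact hpq _ hi

namespace IsInitialPattern

variable {p q : PluckerLabel → Prop} {b c d : ℝ}

theorem mono (h : IsInitialPattern p q b c d) (l : PluckerLabel) (hl : p l) : q l :=
  ((h.iff_excess_eq_zero l).mp hl).1

theorem excess_eq_zero (h : IsInitialPattern p q b c d) {l : PluckerLabel} (hl : p l) :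
    excess b c d l = 0 :=
  ((h.iff_excess_eq_zero l).mp hl).2

theorem not_of_neg (h : IsInitialPattern p q b c d) (l : PluckerLabel)
    (hl : excess b c d l < 0) : ¬ q l :=
  fun hq => hl.not_ge (h.excess_nonneg l hq)

theorem of_excess_eq_zero (h : IsInitialPattern p q b c d) {l : PluckerLabel} (hl : q l)
    (h0 : excess b c d l = 0) : p l :=
  (h.iff_excess_eq_zero l).mpr ⟨hl, h0⟩

theorem eq_zero_or (h : IsInitialPattern p q b c d)
    (hne : ∀ l, ∃ m, m ≠ l ∧ m.level = l.level ∧ p m) :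
    d = 0 ∨ c = 0 ∧ b = d ∧ p p3 ∧ p p134 := by
  have level_zero : d = 0 ∨ b = 0 ∨ c = 0 ∧ p p3 := by
    obtain ⟨m, hm, hl, hpm⟩ := hne p1
    have h0 := h.excess_eq_zero hpm
    cases m <;> simp_all [level, excess]
  have level_one : c = b ∨ d = b ∨ c = 0 ∨ d = 0 ∨ c + d = b := by
    obtain ⟨m, hm, hl, hpm⟩ := hne p12
    have h0 := h.excess_eq_zero hpm
    cases m <;> simp_all [level, excess, sub_eq_zero]
  have level_two : d = 0 ∨ d = b ∧ p p134 ∨ d = c := by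
    obtain ⟨m, hm, hl, hpm⟩ := hne p123
    have h0 := h.excess_eq_zero hpm
    cases m <;> simp_all [level, excess, sub_eq_zero]
  grind

theorem exists_isCoordSystem_of_neg (h : IsInitialPattern p q b c d) (hp : IsFlagPattern p)
    (hq : IsFlagPattern q) (hb : b < 0) (hd : d = 0 ∨ c = 0 ∧ b = d ∧ p p34 ∧ p p134) :
    ∃ I I', I ⊆ I' ∧ IsCoordSystem p I ∧ IsCoordSystem q I' := by
  have hq2 : ¬ q p2 := h.not_of_neg p2 hb
  refine ⟨_, _, coordsRight_subset h.mono (fun h3 h124 => ?_) (fun h14 => ?_),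
    hp.isCoordSystem_of_not_p2 (mt (h.mono _) hq2), hq.isCoordSystem_of_not_p2 hq2⟩
  · have hc : c = 0 := h.excess_eq_zero h3
    have hdc : 0 ≤ d - c := h.excess_nonneg _ h124
    have hd0 : d = 0 := by grind
    exact h.of_excess_eq_zero h124 (by simp [excess, hc, hd0])
  · have hdb : d - b = 0 := h.excess_eq_zero h14
    obtain ⟨-, -, h34, h134⟩ := hd.resolve_left (by linarith)
    exact ⟨h.mono _ h34, h.mono _ h134⟩

theorem exists_isCoordSystem_of_zero (h : IsInitialPattern p q b c 0) (hp : IsFlagPattern p)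
    (hq : IsFlagPattern q) (hb : 0 ≤ b) :
    p = q ∨ ∃ I I', I ⊆ I' ∧ IsCoordSystem p I ∧ IsCoordSystem q I' := by
  have p2_of_p14 (h14 : p p14) (h2 : q p2) : p p2 :=
    h.of_excess_eq_zero h2 (by simpa [excess] using h.excess_eq_zero h14)
  rcases lt_trichotomy c 0 with hc | rfl | hc
  · have h3 : ¬ q p3 := h.not_of_neg p3 hc
    have h13 : ¬ q p13 := h.not_of_neg p13 (by simp only [excess]; linarith)
    have h23 : ¬ q p23 := h.not_of_neg p23 hc
    have h34 : ¬ q p34 := h.not_of_neg p34 (by simp only [excess]; linarith)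
    exact Or.inr ⟨_, _, coordsLeft_subset h.mono (mt (h.mono _) h3) p2_of_p14,
      hp.isCoordSystem_of_not_p3 (mt (h.mono _) h3) (mt (h.mono _) h13) (mt (h.mono _) h23)
        (mt (h.mono _) h34),
      hq.isCoordSystem_of_not_p3 h3 h13 h23 h34⟩
  · rcases hb.eq_or_lt' with rfl | hb
    · refine Or.inl (funext fun l => propext ⟨h.mono l, fun hl => h.of_excess_eq_zero hl ?_⟩)
      cases l <;> simp [excess]
    · have h13 : ¬ q p13 := h.not_of_neg p13 (by simpa [excess] using hb)
      have h14 : ¬ q p14 := h.not_of_neg p14 (by simpa [excess] using hb)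
      have h34 : ¬ q p34 := h.not_of_neg p34 (by simpa [excess] using hb)
      have h134 : ¬ q p134 := h.not_of_neg p134 (by simpa [excess] using hb)
      exact Or.inr ⟨_, _, coordsRight_subset h.mono
          (fun _ h124 => h.of_excess_eq_zero h124 (by simp [excess]))
          fun H => absurd (h.mono _ H) h14,
        hp.isCoordSystem_of_not_p134 (mt (h.mono _) h13) (mt (h.mono _) h14) (mt (h.mono _) h34)
          (mt (h.mono _) h134),
        hq.isCoordSystem_of_not_p134 h13 h14 h34 h134⟩
  · have h3 : ¬ p p3 := fun h3 => hc.ne' (h.excess_eq_zero h3)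
    have h124 : ¬ q p124 := h.not_of_neg p124 (by simpa [excess] using hc)
    exact Or.inr ⟨_, _, coordsLeft_subset h.mono h3 p2_of_p14,
      hp.isCoordSystem_of_not_p124 (mt (h.mono _) h124), hq.isCoordSystem_of_not_p124 h124⟩

theorem exists_isCoordSystem (h : IsInitialPattern p q b c d) (hp : IsFlagPattern p)
    (hq : IsFlagPattern q) (hne : ∀ l, ∃ m, m ≠ l ∧ m.level = l.level ∧ p m) :
    p = q ∨ ∃ I I', I ⊆ I' ∧ IsCoordSystem p I ∧ IsCoordSystem q I' := by
  rcases eq_or_ne d 0 with rfl | hd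
  · rcases lt_or_ge b 0 with hb | hb
    · exact Or.inr (h.exists_isCoordSystem_of_neg hp hq hb (Or.inl rfl))
    · exact h.exists_isCoordSystem_of_zero hp hq hb
  obtain ⟨rfl, rfl, h3, h134⟩ := (h.eq_zero_or hne).resolve_left hd
  have h13 : ¬ p p13 := fun H => hd (by simpa [excess] using h.excess_eq_zero H)
  have h14 : p p14 := (hp.rel_p134.2.2 h134).resolve_left fun H => h13 H.2
  have h23 : p p23 := (hp.rel_p23.2.1 h3).resolve_left fun H => h13 H.2
  have h34 : p p34 := (hp.rel_p34.1 ⟨h3, h14⟩).resolve_left fun H => h13 H.2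
  rcases hd.lt_or_gt with hb | hb
  · exact Or.inr (h.exists_isCoordSystem_of_neg hp hq hb (Or.inr ⟨rfl, rfl, h34, h134⟩))
  · have hq13 : ¬ q p13 := h.not_of_neg p13 (by simpa [excess] using hb)
    exact Or.inr ⟨_, _, coordsMiddle_subset h.mono fun h4 => hd (h.excess_eq_zero h4),
      hp.isCoordSystem_of_not_p13 h13 h3 h14 h23 h34 h134,
      hq.isCoordSystem_of_not_p13 hq13 (h.mono _ h3) (h.mono _ h14) (h.mono _ h23) (h.mono _ h34)
        (h.mono _ h134)⟩

end IsInitialPattern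

end FacePatterns

section Exchange

open PluckerLabel

/-- A pair of bases with labels `x` can be exchanged only for pairs in `K` when the column that
leaves the first basis is chosen suitably. -/
def PluckerLabel.ExchangesTo (x : PluckerLabel × PluckerLabel)
    (K : List (PluckerLabel × PluckerLabel)) : Prop :=
  x.1.level ≤ x.2.level ∧ ∃ a ∈ x.1.columnSet \ x.2.columnSet,
    ∀ b ∈ x.2.columnSet \ x.1.columnSet, ∃ y ∈ K, y.1.level = x.1.level ∧ y.2.level = x.2.level ∧
      y.1.columnSet = insert b (x.1.columnSet.erase a) ∧
      y.2.columnSet = insert a (x.2.columnSet.erase b)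

instance PluckerLabel.decidableExchangesTo (x : PluckerLabel × PluckerLabel)
    (K : List (PluckerLabel × PluckerLabel)) : Decidable (ExchangesTo x K) :=
  inferInstanceAs (Decidable (_ ∧ _))

namespace FlagMatroid

variable {Q : FlagMatroid 4 ![1, 2, 3]} {σ : Equiv.Perm (Fin 4)}

theorem has_iff {l : PluckerLabel} : Q.Has σ l ↔ l.columnSet.map σ.toEmbedding ∈ Q.bases l.level :=
  iff_of_eq (congrArg (· ∈ Q.bases l.level) (map_columnsVia σ l))

theorem exists_has_of_exchangesTo {x : PluckerLabel × PluckerLabel}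
    {K : List (PluckerLabel × PluckerLabel)} (hK : ExchangesTo x K) (h₁ : Q.Has σ x.1)
    (h₂ : Q.Has σ x.2) : ∃ y ∈ K, Q.Has σ y.1 ∧ Q.Has σ y.2 := by
  obtain ⟨hle, a, ha, hK⟩ := hK
  obtain ⟨ha₁, ha₂⟩ := Finset.mem_sdiff.mp ha
  obtain ⟨f, hf₂, hf₁, hb, hc⟩ := Q.exists_exchange hle (has_iff.mp h₁) (has_iff.mp h₂)
    (Finset.mem_map_of_mem _ ha₁) (by simpa using ha₂)
  obtain ⟨b, hb₂, rfl⟩ := Finset.mem_map.mp hf₂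
  obtain ⟨y, hy, level₁, level₂, columns₁, columns₂⟩ :=
    hK b (Finset.mem_sdiff.mpr ⟨hb₂, by simpa using hf₁⟩)
  rw [← Finset.map_erase, ← Finset.map_insert] at hb hc
  exact ⟨y, hy, has_iff.mpr (level₁ ▸ columns₁ ▸ hb), has_iff.mpr (level₂ ▸ columns₂ ▸ hc)⟩

theorem notExactlyOne_has {x y z : PluckerLabel × PluckerLabel}
    {K : List (PluckerLabel × PluckerLabel)} (hK : ∀ k ∈ K, ¬(Q.Has σ k.1 ∧ Q.Has σ k.2))
    (h : ExchangesTo x (y :: z :: K) ∧ ExchangesTo y (x :: z :: K) ∧ ExchangesTo z (x :: y :: K)) :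
    NotExactlyOne (Q.Has σ x.1 ∧ Q.Has σ x.2) (Q.Has σ y.1 ∧ Q.Has σ y.2)
      (Q.Has σ z.1 ∧ Q.Has σ z.2) := by
  have or_of_exchangesTo {u v w : PluckerLabel × PluckerLabel} (he : ExchangesTo u (v :: w :: K))
      (hu : Q.Has σ u.1 ∧ Q.Has σ u.2) :
      Q.Has σ v.1 ∧ Q.Has σ v.2 ∨ Q.Has σ w.1 ∧ Q.Has σ w.2 := by
    obtain ⟨k, hk, hk'⟩ := exists_has_of_exchangesTo he hu.1 hu.2
    simp only [List.mem_cons] at hk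
    rcases hk with rfl | rfl | hk
    exacts [Or.inl hk', Or.inr hk', absurd hk' (hK k hk)]
  exact ⟨or_of_exchangesTo h.1, or_of_exchangesTo h.2.1, or_of_exchangesTo h.2.2⟩

theorem IsChart.isFlagPattern (hσ : Q.IsChart σ) : IsFlagPattern (Q.Has σ) := by
  obtain ⟨h1, h12, h123⟩ := Q.isChart_iff.mp hσ
  have three_term {x y z : PluckerLabel × PluckerLabel} :=
    notExactlyOne_has (Q := Q) (σ := σ) (x := x) (y := y) (z := z) (K := []) (by simp)
  have four_term (h : ¬(Q.Has σ p2 ∧ Q.Has σ p134)) :=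
    notExactlyOne_has (Q := Q) (σ := σ) (x := (p3, p124)) (y := (p4, p123)) (z := (p1, p234))
      (K := [(p2, p134)]) (by simpa using h)
  refine ⟨h1, h12, h123, ?_, ?_, ?_, ?_, ?_, ?_, ?_, ?_⟩
  · simpa only [h1, h12, true_and, and_true] using
      three_term (x := (p2, p13)) (y := (p3, p12)) (z := (p1, p23)) (by decide)
  · simpa only [h1, h12, true_and, and_true] using
      three_term (x := (p2, p14)) (y := (p4, p12)) (z := (p1, p24)) (by decide)
  · simpa only [h1, true_and] using
      three_term (x := (p3, p14)) (y := (p4, p13)) (z := (p1, p34)) (by decide)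
  · simpa only [h12, true_and] using
      three_term (x := (p13, p24)) (y := (p14, p23)) (z := (p12, p34)) (by decide)
  · simpa only [h12, h123, true_and, and_true, and_comm] using
      three_term (x := (p13, p124)) (y := (p14, p123)) (z := (p12, p134)) (by decide)
  · simpa only [h12, h123, true_and, and_true] using
      three_term (x := (p23, p124)) (y := (p24, p123)) (z := (p12, p234)) (by decide)
  · simpa only [h123, and_true] using
      three_term (x := (p13, p234)) (y := (p23, p134)) (z := (p34, p123)) (by decide)
  · intro h
    simpa only [h1, h123, true_and, and_true, and_comm] using four_term h (by decide)

end FlagMatroid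

end Exchange

section FlagsOfBases

theorem exists_perm_map_castLEEmb {n s : ℕ} {r : Fin s → ℕ} (hr : ∀ i, r i ≤ n)
    {S : Fin s → Finset (Fin n)} (hS : Monotone S) (card_S : ∀ i, (S i).card = r i) :
    ∃ σ : Equiv.Perm (Fin n),
      ∀ i, Finset.univ.map ((Fin.castLEEmb (hr i)).trans σ.toEmbedding) = S i := by
  -- Sort the elements by the number of steps they miss; then each `S i` comes first.
  let missed (x : Fin n) : ℕ := (Finset.univ.filter fun i => x ∉ S i).card
  have mem_of_missed_le {i : Fin s} {x y : Fin n} (hx : x ∈ S i) (h : missed y ≤ missed x) :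
      y ∈ S i := by
    by_contra hy
    refine h.not_gt (Finset.card_lt_card (Finset.ssubset_iff_exists_cons_subset.mpr ?_))
    refine ⟨i, by simpa using hx, fun j hj => ?_⟩
    rw [Finset.mem_cons, Finset.mem_filter_univ] at hj
    rw [Finset.mem_filter_univ]
    rcases hj with rfl | hj
    · exact hy
    · exact fun hyj => hy (hS (le_of_not_ge fun hij => hj (hS hij hx)) hyj)
  let σ : Equiv.Perm (Fin n) := Tuple.sort missed
  refine ⟨σ, fun i => ?_⟩
  have isLowerSet_initial :
      IsLowerSet (Finset.univ.map (Fin.castLEEmb (hr i)) : Set (Fin n)) := fun k l hlk hk => by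
    obtain ⟨m, -, rfl⟩ := Finset.mem_map.mp hk
    exact Finset.mem_map.mpr ⟨⟨l, (Fin.le_def.mp hlk).trans_lt m.isLt⟩, Finset.mem_univ _, rfl⟩
  have isLowerSet_preimage : IsLowerSet ((S i).map σ.symm.toEmbedding : Set (Fin n)) :=
    fun k l hlk hk => Finset.mem_map_equiv.mpr
      (mem_of_missed_le (Finset.mem_map_equiv.mp hk) (Tuple.monotone_sort missed hlk))
  have initial_eq_preimage :
      Finset.univ.map (Fin.castLEEmb (hr i)) = (S i).map σ.symm.toEmbedding := by
    rcases isLowerSet_initial.total isLowerSet_preimage with h | h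
    · exact Finset.eq_of_subset_of_card_le (Finset.coe_subset.mp h) (by simp [card_S])
    · exact (Finset.eq_of_subset_of_card_le (Finset.coe_subset.mp h) (by simp [card_S])).symm
  rw [← Finset.map_map, initial_eq_preimage, Finset.map_map]
  simp

namespace FlagMatroid

theorem exists_bases_subset {n s : ℕ} {r : Fin s → ℕ} (Q : FlagMatroid n r) {i j : Fin s}
    (hij : i ≤ j) {c : Finset (Fin n)} (hc : c ∈ Q.bases j) : ∃ b ∈ Q.bases i, b ⊆ c := by
  obtain ⟨b, hb, hmin⟩ := (Q.bases i).exists_min_image (fun b => (b \ c).card) (Set.toFinite _)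
    (Q.bases_nonempty i)
  refine ⟨b, hb, fun e heb => by_contra fun hec => ?_⟩
  obtain ⟨f, hf, -, hb', -⟩ := Q.exists_exchange hij hb hc heb hec
  refine (hmin _ hb').not_gt ?_
  rw [Finset.insert_sdiff_of_mem _ hf, Finset.erase_sdiff_comm]
  exact Finset.card_erase_lt_of_mem (Finset.mem_sdiff.mpr ⟨heb, hec⟩)

theorem exists_isChart (Q : FlagMatroid 4 ![1, 2, 3]) : ∃ σ, Q.IsChart σ := by
  obtain ⟨c, hc⟩ := Q.bases_nonempty 2
  obtain ⟨b, hb, hbc⟩ := Q.exists_bases_subset (show (1 : Fin 3) ≤ 2 by decide) hc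
  obtain ⟨a, ha, hab⟩ := Q.exists_bases_subset (show (0 : Fin 3) ≤ 1 by decide) hb
  have mem_bases (i : Fin 3) : ![a, b, c] i ∈ Q.bases i := by
    fin_cases i <;> assumption
  have monotone : Monotone ![a, b, c] :=
    Fin.monotone_iff_le_succ.mpr (Fin.forall_fin_two.mpr ⟨hab, hbc⟩)
  obtain ⟨σ, hσ⟩ := exists_perm_map_castLEEmb PluckerLabel.rank_le monotone
    fun i => Q.card_of_mem_bases (mem_bases i)
  refine ⟨σ, fun i => ?_⟩
  rw [PluckerLabel.initialColumnsVia, hσ]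
  exact mem_bases i

end FlagMatroid

end FlagsOfBases

section FaceMorphism

open PluckerLabel

namespace FlagMatroid

theorem faceHom_eq_id {n s : ℕ} {r : Fin s → ℕ} {Q : FlagMatroid n r} (h : Q.IsFace Q) :
    faceHom h = AlgHom.id ℂ Q.coordRing := by
  have faceHomR_eq_id : faceHomR h = AlgHom.id ℂ Q.RRing :=
    Q.algHom_ext fun ⟨(_, b), hb⟩ => faceHomR_coord h ⟨b, hb⟩
  ext f
  exact DFunLike.congr_fun faceHomR_eq_id (f : Q.RRing)

variable {P Q : FlagMatroid 4 ![1, 2, 3]}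

theorem eq_of_has_eq (σ : Equiv.Perm (Fin 4)) (h : P.Has σ = Q.Has σ) : P = Q := by
  refine ext_bases fun i => Set.ext fun S => ?_
  by_cases hS : S.card = (![1, 2, 3] : Fin 3 → ℕ) i
  · obtain ⟨l, rfl, rfl⟩ := exists_map_columnsVia_eq σ i S hS
    exact iff_of_eq (congrFun h l)
  · exact iff_of_false (mt P.card_of_mem_bases hS) (mt Q.card_of_mem_bases hS)

theorem IsInternal.exists_has_ne (hP : P.IsInternal) (σ : Equiv.Perm (Fin 4)) (l : PluckerLabel) :
    ∃ m, m ≠ l ∧ m.level = l.level ∧ P.Has σ m := by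
  obtain ⟨S, hS, hSl⟩ := hP.exists_ne (i := l.level) (by cases l <;> decide)
    (by cases l <;> decide) (Finset.univ.map (l.columnsVia σ))
  obtain ⟨m, hml, rfl⟩ := exists_map_columnsVia_eq σ _ S (P.card_of_mem_bases hS)
  refine ⟨m, ?_, hml, ?_⟩
  · rintro rfl
    exact hSl rfl
  · rw [← hml] at hS
    exact hS

theorem IsFace.exists_isInitialPattern {σ : Equiv.Perm (Fin 4)} (hPQ : P.IsFace Q)
    (hσ : P.IsChart σ) : ∃ b c d, IsInitialPattern (P.Has σ) (Q.Has σ) b c d := by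
  have mono {l : PluckerLabel} (hl : P.Has σ l) : Q.Has σ l := hl.mono hPQ
  obtain ⟨v, hv⟩ := hPQ
  let w (k : Fin 4) : ℝ := v (σ k)
  let ε := excess (w 1 - w 0) (w 2 - w 0) (w 3 - w 0)
  have has_iff_minimal (l : PluckerLabel) :
      P.Has σ l ↔ Q.Has σ l ∧ ∀ m, Q.Has σ m → m.level = l.level → ε l ≤ ε m := by
    have sum_eq (l : PluckerLabel) : ∑ j ∈ l.columnSet.map σ.toEmbedding, v j =
        ε l + ![w 0, w 0 + w 1, w 0 + w 1 + w 2] l.level :=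
      (Finset.sum_map _ _ _).trans (sum_columnSet w l)
    rw [has_iff, hv, Set.mem_ofPred_eq, ← has_iff]
    refine and_congr_right fun _ => ⟨fun h m hm hml => ?_, fun h S hS => ?_⟩
    · have hle := h _ (hml ▸ has_iff.mp hm)
      rwa [sum_eq, sum_eq, hml, add_le_add_iff_right] at hle
    · obtain ⟨m, hml, rfl⟩ := exists_map_columnsVia_eq σ _ S (Q.card_of_mem_bases hS)
      rw [map_columnsVia, sum_eq, sum_eq, hml, add_le_add_iff_right]
      exact h m (by rw [← hml] at hS; exact hS) hml
  have exists_excess_eq_zero (l : PluckerLabel) : ∃ m, P.Has σ m ∧ m.level = l.level ∧ ε m = 0 := by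
    obtain ⟨h1, h12, h123⟩ := P.isChart_iff.mp hσ
    cases l
    case p1 | p2 | p3 | p4 => exact ⟨p1, h1, rfl, rfl⟩
    case p12 | p13 | p14 | p23 | p24 | p34 => exact ⟨p12, h12, rfl, rfl⟩
    case p123 | p124 | p134 | p234 => exact ⟨p123, h123, rfl, rfl⟩
  have excess_nonneg (l : PluckerLabel) (hl : Q.Has σ l) : 0 ≤ ε l := by
    obtain ⟨m, hm, hml, hm0⟩ := exists_excess_eq_zero l
    exact hm0 ▸ ((has_iff_minimal m).mp hm).2 l hl hml.symm
  refine ⟨_, _, _, excess_nonneg, fun l => ⟨fun hl => ⟨mono hl, ?_⟩, fun ⟨hl, h0⟩ => ?_⟩⟩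
  · obtain ⟨m, hm, hml, hm0⟩ := exists_excess_eq_zero l
    exact ((((has_iff_minimal l).mp hl).2 m (mono hm) hml).trans_eq hm0).antisymm
      (excess_nonneg l (mono hl))
  · exact (has_iff_minimal l).mpr ⟨hl, fun m hm _ => h0.le.trans (excess_nonneg m hm)⟩

theorem IsFace.isSmoothConnected (hPQ : P.IsFace Q) (hP : P.IsInternal) :
    IsSmoothConnected (faceHom hPQ).toRingHom := by
  obtain ⟨σ, hσ⟩ := P.exists_isChart
  obtain ⟨b, c, d, hbcd⟩ := hPQ.exists_isInitialPattern hσ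
  rcases hbcd.exists_isCoordSystem hσ.isFlagPattern (hσ.mono hPQ).isFlagPattern
    (hP.exists_has_ne σ) with heq | ⟨I, I', hI, hPI, hQI⟩
  · obtain rfl := eq_of_has_eq σ heq
    rw [faceHom_eq_id hPQ]
    exact .of_bijective Function.bijective_id
  · exact isSmoothConnected_faceHom hPQ hσ hI hPI hQI

end FlagMatroid

end FaceMorphism

theorem mainTheorem6_general (P Q : FlagMatroid 4 ![1, 2, 3]) (hPQ : P.IsFace Q)
    (hP : P.IsInternal) :
    Smooth (FlagMatroid.faceMorphism hPQ) ∧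
      IsDominant (FlagMatroid.faceMorphism hPQ) ∧
      ∀ y ∈ Set.range (FlagMatroid.faceMorphism hPQ),
        ConnectedSpace ((FlagMatroid.faceMorphism hPQ).fiber y) :=
  (hPQ.isSmoothConnected hP).spec

theorem mainTheorem6 (P Q : FlagMatroid 4 ![1, 2, 3]) (hQ : Q.polytopeDim = 3)
    (hPQ : P.IsFace Q) (hP : P.IsInternal) :
    Smooth (FlagMatroid.faceMorphism hPQ) ∧
      IsDominant (FlagMatroid.faceMorphism hPQ) ∧
      ∀ y ∈ Set.range (FlagMatroid.faceMorphism hPQ),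
        ConnectedSpace ((FlagMatroid.faceMorphism hPQ).fiber y) :=
  mainTheorem6_general P Q hPQ hP
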